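/- Let $\tau_1,\tau_2,\dots$ be i.i.d. strictly positive random variables with finite mean $\mathbb E\tau=1/\lambda$, let $T_n=\tau_1+\dots+\tau_n$ and let $N_t=\#\{n\ge 1: T_n\le t\}$ be the associated renewal process. Let $Y_1,Y_2,\dots$ be i.i.d. real random variables, independent of $(\tau_n)_{n\ge1}$, with finite negative mean $b=\mathbb E Y_1<0$. Consider the compound renewal process $X_t=\sum_{i=1}^{N_t}Y_i$ and its running maximum $M_t=\max_{u\in[0,t]}X_u$. Let $B$ be the distribution of $Y_1^+=\max(Y_1,0)$ with tail $\overline B(x)=\mathbb P\{Y_1^+>x\}$, and suppose that $B$ is strong subexponential, that is, $B$ has finite mean, $\overline B(x)>0$ for all $x$, and $$\int_0^x\overline B(x-y)\overline B(y)\,dy\sim 2\overline B(x)\int_0^\infty\overline B(y)\,dy\qquad\text{as }x\to\infty.$$ Then $\mathbb E N_t<\infty$ for every $t>0$ and $$\mathbb P\{M_t>x\}\sim\frac1{|b|}\int_x^{x+|b|\mathbb E N_t}\overline B(v)\,dv\qquad\text{as }x\to\infty,\text{ uniformly for all }t>0,$$ which means: for every $\varepsilon>0$ there is an $x_0$ such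 that, for all $x\ge x_0$ and all $t>0$, the difference of the two sides is at most $\varepsilon$ times the right-hand side in absolute value. In particular, $$\mathbb P\{M_t>x\}\sim\frac1{|b|}\int_x^{x+|b|\lambda t}\overline B(v)\,dv\qquad\text{as }x,t\to\infty.$$ -/

import Mathlib

open MeasureTheory ProbabilityTheory Filter Set
open scoped Topology Asymptotics

namespace CompoundRenewal

noncomputable section

/-- The tail `x ↦ F(x, ∞)` of a distribution `F` on the real line. -/
def tail (F : Measure ℝ) (x : ℝ) : ℝ := F.real (Ioi x)

/-- Strong subexponential distributions (the class `𝒮*`): probability distributions on `ℝ` with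
right-unbounded support and finite mean such that, as `x → ∞`,
`∫₀ˣ F(x - y, ∞) F(y, ∞) dy ∼ 2 F(x, ∞) ∫₀^∞ F(y, ∞) dy`. -/
structure IsStrongSubexponential (F : Measure ℝ) : Prop where
  isProbabilityMeasure : IsProbabilityMeasure F
  unbounded : ∀ x : ℝ, 0 < tail F x
  finite_mean : Integrable (fun y : ℝ => y) F
  convolution_equivalent :
    (fun x : ℝ => ∫ y in (0 : ℝ)..x, tail F (x - y) * tail F y) ~[atTop]
      (fun x : ℝ => 2 * tail F x * ∫ y in Ioi (0 : ℝ), tail F y)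

variable {Ω : Type*}

/-- The renewal epochs `T_0 = 0`, `T_n = τ_1 + ⋯ + τ_n`; here `τ i` is the `(i+1)`-st
inter-renewal time. -/
def epoch (τ : ℕ → Ω → ℝ) (n : ℕ) (ω : Ω) : ℝ := ∑ i ∈ Finset.range n, τ i ω

/-- The renewal process `N_t`: the number of `n ≥ 1` with `T_n ≤ t`. For almost every `ω` this is
the cardinality of a finite set when the `τ i` are i.i.d. and positive. -/
def count (τ : ℕ → Ω → ℝ) (t : ℝ) (ω : Ω) : ℕ := {n : ℕ | 1 ≤ n ∧ epoch τ n ω ≤ t}.ncard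

/-- The compound renewal process `X_t = Y_1 + ⋯ + Y_{N_t}`; here `Y i` is the `(i+1)`-st jump. -/
def process (τ Y : ℕ → Ω → ℝ) (t : ℝ) (ω : Ω) : ℝ := ∑ i ∈ Finset.range (count τ t ω), Y i ω

/-- The running maximum `M_t = max_{u ∈ [0, t]} X_u`. For almost every `ω` the path takes only
finitely many values on `[0, t]`, so the supremum is a maximum. -/
def runningMax (τ Y : ℕ → Ω → ℝ) (t : ℝ) (ω : Ω) : ℝ :=
  sSup ((fun u : ℝ => process τ Y u ω) '' Icc 0 t)

/-- The expectation `E N_t`. -/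
def meanCount [MeasurableSpace Ω] (μ : Measure Ω) (τ : ℕ → Ω → ℝ) (t : ℝ) : ℝ :=
  ∫ ω, (count τ t ω : ℝ) ∂μ

end

end CompoundRenewal

/-! Write `S_k = Y_1 + ⋯ + Y_k` and `a = |b|`. Almost surely `M_t` is the maximum of `S_k` over `k ≤
N_t`, and `N_t` is independent of the jumps, so `P(M_t > x)` is the average over `n = N_t` of the
probability that `S` exceeds `x` within `n` steps. Two facts then suffice.

(1) Fixed horizon: uniformly in `n`, this probability is asymptotic to `(1/a) ∫_x^{x+na}` of the
tail. One big jump is responsible: `S_k` is near `-ak`, so the next jump must exceed about `x + ak`,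
and summing over `k < n` gives the integral. Lower bound (`eventually_le_measureReal_exceed`): the
strong law keeps the walk in a linear corridor with probability near 1, and the contributions of the
steps are disjoint. Upper bound (`exists_supersolution`, `measureReal_exceed_le`): the function
`(1/a) ∫_x^{x+na} D`, capped at 1, dominates its own average over one step; `D` is the tail times a
slowly varying factor that is large at low levels and tends to a constant near 1. Negative drift
pays for the single big jump, and the class `𝒮*` makes the remaining errors small relative to the
tail.

(2) Random horizon: `z ↦ ∫_x^{x+z}` of the tail is concave, so Jensen gives the upper bound with `E
N_t` in place of `N_t` (`integral_window_count_le`). For the lower bound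
(`eventually_le_integral_window_count`), large `t` uses that `N_t` is rarely much below its mean;
for bounded `t` the count is truncated at a fixed `J`, and the tail is almost constant on `[x, x +
Ja]`, so the integral is nearly linear in the count.

The last claim follows from the elementary renewal theorem and the same concavity. -/

namespace CompoundRenewal

/-! ### Tails of distributions -/

section Tail

variable {F : Measure ℝ}

lemma tail_nonneg (x : ℝ) : 0 ≤ tail F x := measureReal_nonneg

lemma tail_antitone [IsFiniteMeasure F] : Antitone (tail F) := fun _ _ h =>
  measureReal_mono (Ioi_subset_Ioi h)

lemma tail_le_one [IsProbabilityMeasure F] (x : ℝ) : tail F x ≤ 1 := measureReal_le_one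

lemma integrableOn_tail [IsFiniteMeasure F] (h : Integrable (fun y : ℝ => y) F) :
    IntegrableOn (tail F) (Ioi 0) := by
  have hpos : Integrable (fun y : ℝ => max y 0) F := h.pos_part
  refine ⟨tail_antitone.measurable.aestronglyMeasurable, ?_⟩
  have h1 := lintegral_eq_lintegral_meas_lt F (f := fun y : ℝ => max y 0)
    (Eventually.of_forall fun y => le_max_right _ _) hpos.aemeasurable
  have h2 : ∫⁻ t in Ioi (0 : ℝ), F {a | t < max a 0} = ∫⁻ t in Ioi (0 : ℝ), ‖tail F t‖ₑ := by
    refine setLIntegral_congr_fun measurableSet_Ioi fun t ht => ?_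
    have : {a : ℝ | t < max a 0} = Ioi t := by
      ext a
      simp only [mem_ofPred_eq, lt_max_iff, mem_Ioi]
      exact ⟨fun h => h.resolve_right (not_lt.2 (le_of_lt ht)), Or.inl⟩
    simp only [this]
    rw [Real.enorm_eq_ofReal (tail_nonneg t), tail, ofReal_measureReal]
  rw [HasFiniteIntegral, ← h2, ← h1]
  exact hpos.lintegral_lt_top

end Tail

/-! ### Consequences of strong subexponentiality -/

namespace IsStrongSubexponential

variable {F : Measure ℝ}

lemma integral_tail_pos (hF : IsStrongSubexponential F) (h : ℝ) (hh : 0 ≤ h) :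
    0 < ∫ y in Ioi h, tail F y := by
  have := hF.isProbabilityMeasure
  have hi : IntegrableOn (tail F) (Ioi h) :=
    (integrableOn_tail hF.finite_mean).mono_set (Ioi_subset_Ioi hh)
  rw [setIntegral_pos_iff_support_of_nonneg_ae (Eventually.of_forall fun y => tail_nonneg y) hi]
  have : Function.support (tail F) = univ := by
    ext x; simpa using (hF.unbounded x).ne'
  simp [this]

lemma eventually_convolution_le (hF : IsStrongSubexponential F) {ε : ℝ} (hε : 0 < ε) :
    ∀ᶠ x in atTop, ∫ y in (0 : ℝ)..x, tail F (x - y) * tail F y ≤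
      (2 * (∫ y in Ioi (0 : ℝ), tail F y) + ε) * tail F x := by
  have := hF.isProbabilityMeasure
  have hm := hF.integral_tail_pos 0 le_rfl
  set m := ∫ y in Ioi (0 : ℝ), tail F y
  filter_upwards [hF.convolution_equivalent.isLittleO.bound (c := ε / (2 * m)) (by positivity)]
    with x hx
  have hx0 := hF.unbounded x
  simp only [Pi.sub_apply, Real.norm_eq_abs] at hx
  have h1 := (le_abs_self _).trans hx
  rw [abs_of_nonneg (show 0 ≤ 2 * tail F x * m by positivity)] at h1
  have h2 : ε / (2 * m) * (2 * tail F x * m) = ε * tail F x := by field_simp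
  linarith

lemma intervalIntegrable_mul_tail [IsFiniteMeasure F] (x a b : ℝ) :
    IntervalIntegrable (fun y => tail F (x - y) * tail F y) volume a b := by
  rw [intervalIntegrable_iff]
  refine Integrable.mul_bdd (c := F.real univ) (intervalIntegrable_iff.1
    (Monotone.intervalIntegrable fun u v h => tail_antitone (by linarith)))
    tail_antitone.measurable.aestronglyMeasurable (Eventually.of_forall fun y => ?_)
  rw [Real.norm_of_nonneg (tail_nonneg y)]
  exact measureReal_mono (subset_univ _)

lemma tendsto_integral_tail (hF : IsStrongSubexponential F) :
    Tendsto (fun A : ℝ => ∫ y in (0 : ℝ)..A, tail F y) atTop (𝓝 (∫ y in Ioi (0 : ℝ), tail F y)) := by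
  have := hF.isProbabilityMeasure
  exact intervalIntegral_tendsto_integral_Ioi 0 (integrableOn_tail hF.finite_mean) tendsto_id

lemma mul_integral_tail_le [IsFiniteMeasure F] (x : ℝ) {a b : ℝ} (h : a ≤ b) :
    tail F (x - a) * ∫ y in a..b, tail F y ≤ ∫ y in a..b, tail F (x - y) * tail F y := by
  rw [← intervalIntegral.integral_const_mul]
  refine intervalIntegral.integral_mono_on h (tail_antitone.intervalIntegrable.const_mul _)
    (intervalIntegrable_mul_tail _ _ _) fun y hy => ?_
  exact mul_le_mul_of_nonneg_right (tail_antitone (by linarith [hy.1])) (tail_nonneg _)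

lemma integral_reflect [IsFiniteMeasure F] (x a b : ℝ) :
    ∫ y in (x - b)..(x - a), tail F (x - y) * tail F y = ∫ y in a..b, tail F (x - y) * tail F y := by
  rw [← intervalIntegral.integral_comp_sub_left (fun y => tail F (x - y) * tail F y)]
  simp [mul_comm]

/-- The end pieces `[0, A]` and `[x - A, x]` of the convolution are equal by reflection, and each is
at least `tail F x` times nearly the whole integral `m` of the tail. Together they use up almost all
of the available `2 m * tail F x`. -/
lemma eventually_middle_le (hF : IsStrongSubexponential F) {ε : ℝ} (hε : 0 < ε) :
    ∀ᶠ A in atTop, ∀ᶠ x in atTop,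
      ∫ y in A..(x - A), tail F y * tail F (x - y) ≤ ε * tail F x := by
  have := hF.isProbabilityMeasure
  set m := ∫ y in Ioi (0 : ℝ), tail F y with hm
  have h1 : ∀ᶠ A in atTop, m - ε / 4 < ∫ y in (0 : ℝ)..A, tail F y :=
    hF.tendsto_integral_tail.eventually (lt_mem_nhds (by linarith))
  filter_upwards [h1, eventually_ge_atTop 0] with A hA hA0
  filter_upwards [hF.eventually_convolution_le (half_pos hε)] with x hx
  have hsplit : (∫ y in (0 : ℝ)..x, tail F (x - y) * tail F y) =
      (∫ y in (0 : ℝ)..A, tail F (x - y) * tail F y) +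
      (∫ y in A..(x - A), tail F (x - y) * tail F y) +
      ∫ y in (x - A)..x, tail F (x - y) * tail F y := by
    rw [intervalIntegral.integral_add_adjacent_intervals (intervalIntegrable_mul_tail _ _ _)
      (intervalIntegrable_mul_tail _ _ _), intervalIntegral.integral_add_adjacent_intervals
      (intervalIntegrable_mul_tail _ _ _) (intervalIntegrable_mul_tail _ _ _)]
  have hr := integral_reflect (F := F) x 0 A
  rw [sub_zero] at hr
  have hl := mul_integral_tail_le (F := F) x hA0
  rw [sub_zero] at hl
  have hl2 : tail F x * (m - ε / 4) ≤ tail F x * ∫ y in (0 : ℝ)..A, tail F y :=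
    mul_le_mul_of_nonneg_left hA.le (tail_nonneg _)
  simp only [mul_comm (tail F _) (tail F (x - _))]
  nlinarith

/-- Long-tailedness. By symmetry, half the convolution lives on `[0, x/2]` and is at most about `m *
tail F x`. The part over `[h, x/2]` carries the weight `tail F (x - h)` and a mass bounded away from
zero, so a relative excess of `tail F (x - h)` over `tail F x` would break this bound. -/
lemma eventually_tail_sub_le (hF : IsStrongSubexponential F) {δ : ℝ} (hδ : 0 < δ) (h : ℝ) :
    ∀ᶠ x in atTop, tail F (x - h) ≤ (1 + δ) * tail F x := by
  have := hF.isProbabilityMeasure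
  wlog hh : 0 < h generalizing h
  · filter_upwards with x
    have h1 : tail F (x - h) ≤ tail F x := tail_antitone (by linarith)
    nlinarith [hF.unbounded x]
  set m := ∫ y in Ioi (0 : ℝ), tail F y with hm
  set r := ∫ y in Ioi h, tail F y with hr
  have hr0 : 0 < r := hF.integral_tail_pos h hh.le
  have hi : IntegrableOn (tail F) (Ioi 0) := integrableOn_tail hF.finite_mean
  have hrm : (∫ y in (0 : ℝ)..h, tail F y) + r = m :=
    intervalIntegral.integral_interval_add_Ioi hi (hi.mono_set (Ioi_subset_Ioi hh.le))
  -- The bound `r / 2` keeps the mass on `[h, x/2]` above `r / 2`; the bound `δ * r / 4` turns the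
  -- total error `2 * γ` into `δ * (r / 2)`.
  set γ := min (r / 2) (δ * r / 4) with hγ
  have hγ0 : 0 < γ := by positivity
  have h1 : ∀ᶠ x in atTop, m - γ < ∫ y in (0 : ℝ)..(x / 2), tail F y :=
    (hF.tendsto_integral_tail.comp (tendsto_id.atTop_div_const two_pos)).eventually
      (lt_mem_nhds (by linarith))
  filter_upwards [h1, hF.eventually_convolution_le (ε := 2 * γ) (by positivity),
    eventually_ge_atTop (2 * h)] with x hx1 hx2 hx3
  have hsplit : (∫ y in (0 : ℝ)..x, tail F (x - y) * tail F y) =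
      (∫ y in (0 : ℝ)..h, tail F (x - y) * tail F y) +
      (∫ y in h..(x / 2), tail F (x - y) * tail F y) +
      ∫ y in (x / 2)..x, tail F (x - y) * tail F y := by
    rw [intervalIntegral.integral_add_adjacent_intervals (intervalIntegrable_mul_tail _ _ _)
      (intervalIntegrable_mul_tail _ _ _), intervalIntegral.integral_add_adjacent_intervals
      (intervalIntegrable_mul_tail _ _ _) (intervalIntegrable_mul_tail _ _ _)]
  have hsplit2 : (∫ y in (0 : ℝ)..(x / 2), tail F (x - y) * tail F y) =
      (∫ y in (0 : ℝ)..h, tail F (x - y) * tail F y) +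
      (∫ y in h..(x / 2), tail F (x - y) * tail F y) := by
    rw [intervalIntegral.integral_add_adjacent_intervals (intervalIntegrable_mul_tail _ _ _)
      (intervalIntegrable_mul_tail _ _ _)]
  have hrefl := integral_reflect (F := F) x 0 (x / 2)
  rw [sub_zero, show x - x / 2 = x / 2 by ring] at hrefl
  have hl1 := mul_integral_tail_le (F := F) x hh.le
  rw [sub_zero] at hl1
  have hl2 := mul_integral_tail_le (F := F) x (show h ≤ x / 2 by linarith)
  have hadd : (∫ y in (0 : ℝ)..h, tail F y) + (∫ y in h..(x / 2), tail F y) =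
      ∫ y in (0 : ℝ)..(x / 2), tail F y :=
    intervalIntegral.integral_add_adjacent_intervals tail_antitone.intervalIntegrable
      tail_antitone.intervalIntegrable
  set p := ∫ y in (0 : ℝ)..h, tail F y
  set J := ∫ y in h..(x / 2), tail F y
  have hJ : r - γ < J := by linarith
  have hx0 := hF.unbounded x
  have hmono : tail F x ≤ tail F (x - h) := tail_antitone (by linarith)
  have key : tail F x * p + tail F (x - h) * J ≤ (m + γ) * tail F x := by linarith
  have hγ1 : γ ≤ r / 2 := min_le_left _ _
  have hγ2 : γ ≤ δ * r / 4 := min_le_right _ _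
  have key2 : (tail F (x - h) - tail F x) * (r / 2) ≤ 2 * γ * tail F x := by
    have : (tail F (x - h) - tail F x) * (r / 2) ≤ (tail F (x - h) - tail F x) * J :=
      mul_le_mul_of_nonneg_left (by linarith) (by linarith)
    nlinarith
  have key3 : (tail F (x - h) - tail F x) * (r / 2) ≤ (δ * tail F x) * (r / 2) := by nlinarith
  have := le_of_mul_le_mul_right key3 (half_pos hr0)
  linarith

end IsStrongSubexponential

/-! ### Integrals of antitone functions over moving windows -/

section Antitone

variable {D : ℝ → ℝ}

lemma integral_le_of_antitone (hD : Antitone D) {a b : ℝ} (h : a ≤ b) :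
    ∫ v in a..b, D v ≤ (b - a) * D a := by
  have := intervalIntegral.integral_mono_on h hD.intervalIntegrable
    (intervalIntegrable_const (μ := volume) (c := D a)) (fun y hy => hD hy.1)
  simpa using this

lemma le_integral_of_antitone (hD : Antitone D) {a b : ℝ} (h : a ≤ b) :
    (b - a) * D b ≤ ∫ v in a..b, D v := by
  have := intervalIntegral.integral_mono_on h (intervalIntegrable_const (μ := volume) (c := D b))
    hD.intervalIntegrable (fun y hy => hD hy.2)
  simpa using this

lemma integral_shift_le_of_antitone (hD : Antitone D) {a b L : ℝ} (h : a ≤ b) (hL : 0 ≤ L) :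
    ∫ v in (a + L)..(b + L), D v ≤ ∫ v in a..b, D v := by
  rw [← intervalIntegral.integral_comp_add_right (f := D)]
  exact intervalIntegral.integral_mono_on h
    (Antitone.intervalIntegrable fun u v huv => hD (by linarith)) hD.intervalIntegrable
    fun y _ => hD (by linarith)

lemma integral_nonneg_of_nonneg (h0 : ∀ v, 0 ≤ D v) {a b : ℝ} (h : a ≤ b) :
    0 ≤ ∫ v in a..b, D v :=
  intervalIntegral.integral_nonneg h fun _ _ => h0 _

lemma integral_adjacent (hD : Antitone D) (a b c : ℝ) :
    (∫ v in a..b, D v) + ∫ v in b..c, D v = ∫ v in a..c, D v :=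
  intervalIntegral.integral_add_adjacent_intervals hD.intervalIntegrable hD.intervalIntegrable

/-- The change of the integral of an antitone function over a window `[x, x + L]` when the window
is moved by `-y`, with jumps `y` truncated at `A` and the excess collected in the last term. -/
lemma integral_window_le (hD : Antitone D) (h0 : ∀ v, 0 ≤ D v) {A x L y : ℝ} (hA : 0 ≤ A)
    (hx : 2 * A ≤ x) (hL : 0 ≤ L) (hy : y ≤ x - A) :
    ∫ v in (x - y)..(x - y + L), D v ≤ (∫ v in x..(x + L), D v) +
      min (max y 0) A * (D (x - A) - D (x + L)) - min (max (-y) 0) A * (D (x + A) - D (x + L)) +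
      ∫ s in A..(x - A), (Iio y).indicator (fun s => D (x - s)) s := by
  have hlast : 0 ≤ ∫ s in A..(x - A), (Iio y).indicator (fun s => D (x - s)) s :=
    intervalIntegral.integral_nonneg (by linarith) fun s _ => indicator_nonneg (fun _ _ => h0 _) _
  rcases le_or_gt y 0 with h | h
  · obtain ⟨z, rfl⟩ : ∃ z, y = -z := ⟨-y, by ring⟩
    have hz : 0 ≤ z := by linarith
    rw [max_eq_right h, neg_neg, max_eq_left hz, min_eq_left hA]
    -- A downward jump moves the window to the right. Only the first `w` of the move is accounted
    -- for; the rest can only lower the integral.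
    set w := min z A
    have hw0 : 0 ≤ w := le_min hz hA
    have hwz : w ≤ z := min_le_left _ _
    have hwA : w ≤ A := min_le_right _ _
    have e1 := integral_adjacent hD x (x - -z) (x - -z + L)
    have e2 := integral_adjacent hD x (x + L) (x - -z + L)
    have e3 := integral_adjacent hD x (x + w) (x - -z)
    have e4 := integral_adjacent hD (x + L) (x + w + L) (x - -z + L)
    have b1 := le_integral_of_antitone hD (show x ≤ x + w by linarith)
    have b2 := integral_le_of_antitone hD (show x + L ≤ x + w + L by linarith)
    have b3 := integral_shift_le_of_antitone hD (show x + w ≤ x - -z by linarith) hL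
    have b4 : D (x + A) ≤ D (x + w) := hD (by linarith)
    have b5 := mul_le_mul_of_nonneg_left b4 hw0
    have e5 : (x + w - x) * D (x + w) = w * D (x + w) := by ring
    have e6 : (x + w + L - (x + L)) * D (x + L) = w * D (x + L) := by ring
    linarith
  · rw [max_eq_left h.le, max_eq_right (by linarith : -y ≤ 0), min_eq_left hA]
    have e1 := integral_adjacent hD (x - y) x (x + L)
    have e2 := integral_adjacent hD (x - y) (x - y + L) (x + L)
    have b1 := le_integral_of_antitone hD (show x - y + L ≤ x + L by linarith)
    have hq := h0 (x + L)
    rcases le_or_gt y A with hyA | hyA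
    · rw [min_eq_left hyA]
      have b2 := integral_le_of_antitone hD (show x - y ≤ x by linarith)
      have b3 : D (x - y) ≤ D (x - A) := hD (by linarith)
      have b4 := mul_le_mul_of_nonneg_left b3 h.le
      have e5 : (x - (x - y)) * D (x - y) = y * D (x - y) := by ring
      have e6 : (x + L - (x - y + L)) * D (x + L) = y * D (x + L) := by ring
      linarith
    · rw [min_eq_right hyA.le]
      have e3 := integral_adjacent hD (x - y) (x - A) x
      have b2 := integral_le_of_antitone hD (show x - A ≤ x by linarith)
      have b4 := mul_le_mul_of_nonneg_right hyA.le hq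
      have e5 : (x - (x - A)) * D (x - A) = A * D (x - A) := by ring
      have e6 : (x + L - (x - y + L)) * D (x + L) = y * D (x + L) := by ring
      -- For a jump above `A`, the stretch `[x - y, x - A]` gained beyond the truncation is exactly
      -- the excess term, after reflection at `x`.
      have e7 : ∫ s in A..(x - A), (Iio y).indicator (fun s => D (x - s)) s =
          ∫ v in (x - y)..(x - A), D v := by
        rw [← intervalIntegral.integral_comp_sub_left (fun v => D v),
          intervalIntegral.integral_of_le (by linarith), intervalIntegral.integral_of_le hyA.le,
          setIntegral_indicator measurableSet_Iio, integral_Ioc_eq_integral_Ioo]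
        congr 2
        ext s
        simp only [mem_inter_iff, mem_Ioc, mem_Iio, mem_Ioo]
        constructor
        · rintro ⟨⟨h1, _⟩, h2⟩; exact ⟨h1, h2⟩
        · rintro ⟨h1, h2⟩; exact ⟨⟨h1, by linarith⟩, h2⟩
      linarith

end Antitone

/-! ### One step of the walk -/

section Step

variable {ν : Measure ℝ} [IsProbabilityMeasure ν] {D : ℝ → ℝ}

lemma integrable_indicator_antitone (hD : Antitone D) (h0 : ∀ v, 0 ≤ D v) (A x : ℝ) :
    Integrable (fun p : ℝ × ℝ => (Iio p.1).indicator (fun s => D (x - s)) p.2)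
      (ν.prod (volume.restrict (Ioc A (x - A)))) := by
  have hm : Measurable fun p : ℝ × ℝ => (Iio p.1).indicator (fun s => D (x - s)) p.2 := by
    have : (fun p : ℝ × ℝ => (Iio p.1).indicator (fun s => D (x - s)) p.2) =
        {p : ℝ × ℝ | p.2 < p.1}.indicator (fun p => D (x - p.2)) := by
      ext p
      simp [indicator]
    rw [this]
    exact (hD.measurable.comp (measurable_snd.const_sub x)).indicator
      (measurableSet_lt measurable_snd measurable_fst)
  refine Integrable.of_bound hm.aestronglyMeasurable (D A) ?_
  have hae : ∀ᵐ s ∂(volume.restrict (Ioc A (x - A))), s ∈ Ioc A (x - A) :=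
    ae_restrict_mem measurableSet_Ioc
  filter_upwards [Measure.quasiMeasurePreserving_snd.ae hae] with p hp
  rw [Real.norm_of_nonneg (indicator_nonneg (fun _ _ => h0 _) _)]
  exact (indicator_le_self' (fun _ _ => h0 _) _).trans (hD (by linarith [hp.2]))

/-- By Fubini, the mean of the excess term becomes the middle part of a convolution, which strong
subexponentiality makes negligible. -/
lemma integral_integral_indicator (hD : Antitone D) (h0 : ∀ v, 0 ≤ D v) {A x : ℝ}
    (hx : 2 * A ≤ x) :
    ∫ y, (∫ s in A..(x - A), (Iio y).indicator (fun s => D (x - s)) s) ∂ν =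
      ∫ s in A..(x - A), ν.real (Ioi s) * D (x - s) := by
  simp only [intervalIntegral.integral_of_le (show A ≤ x - A by linarith)]
  rw [integral_integral_swap (integrable_indicator_antitone hD h0 A x)]
  congr 1
  ext s
  have : (fun y : ℝ => (Iio y).indicator (fun s => D (x - s)) s) =
      (Ioi s).indicator (fun _ => D (x - s)) := by
    ext y; simp [indicator]
  rw [this, integral_indicator_const _ measurableSet_Ioi, smul_eq_mul]

/-- One step of the walk with increment law `ν` from a level `x` decreases the integrated
functional `h_{n+1}` of an antitone function `D`, under smallness conditions at scale `A`. -/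
lemma integral_step_le (hD : Antitone D) (h0 : ∀ v, 0 ≤ D v) {a δ A x M : ℝ} (ha : 0 < a)
    (hint : Integrable (fun y : ℝ => y) ν) (hmean : ∫ y, y ∂ν = -a) (hM : ∫ y, |y| ∂ν = M)
    (hδ : 0 < δ) (haA : a ≤ A) (hx : 2 * A ≤ x)
    (hshift : ∀ v, x ≤ v → D (v - A) ≤ (1 + δ) * D v)
    (htail : ν.real (Ioi (x - A)) ≤ (1 - δ * ((2 + M) / a + 1)) * D x)
    (hmid : ∫ s in A..(x - A), ν.real (Ioi s) * D (x - s) ≤ δ * D x)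
    (hneg : ∫ y, max (-y - A) 0 ∂ν ≤ δ) (n : ℕ) {u : ℝ → ℝ} (hu : Measurable u)
    (hu0 : ∀ z, 0 ≤ u z) (hu1 : ∀ z, u z ≤ 1)
    (huh : ∀ z, A ≤ z → u z ≤ 1 / a * ∫ v in z..(z + n * a), D v) :
    ∫ y, u (x - y) ∂ν ≤ 1 / a * ∫ v in x..(x + (n + 1 : ℕ) * a), D v := by
  have hA : 0 ≤ A := ha.le.trans haA
  set L : ℝ := n * a with hLdef
  have hL : 0 ≤ L := by positivity
  set d := D x with hd
  set q := D (x + L) with hq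
  have hd0 : 0 ≤ d := h0 _
  have hq0 : 0 ≤ q := h0 _
  have hqd : q ≤ d := hD (by linarith)
  have hD1 : D (x - A) ≤ (1 + δ) * d := hshift x le_rfl
  have hbelow : ∀ v, x ≤ v → (1 - δ) * D v ≤ D (v + A) := fun v hv => by
    have h1 := hshift (v + A) (by linarith)
    rw [add_sub_cancel_right] at h1
    have h2 : D (v + A) ≤ D v := hD (by linarith)
    nlinarith [h0 (v + A)]
  have hD2 := hbelow x le_rfl
  set J : ℝ → ℝ := fun y => ∫ s in A..(x - A), (Iio y).indicator (fun s => D (x - s)) s with hJ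
  have hJ0 : ∀ y, 0 ≤ J y := fun y =>
    intervalIntegral.integral_nonneg (by linarith) fun s _ => indicator_nonneg (fun _ _ => h0 _) _
  have hJint : Integrable J ν := by
    have := (integrable_indicator_antitone (ν := ν) hD h0 A x).integral_prod_left
    simpa only [hJ, intervalIntegral.integral_of_le (show A ≤ x - A by linarith)] using this
  have hposI : Integrable (fun y : ℝ => min (max y 0) A) ν := by
    refine Integrable.of_bound (by fun_prop) A (Eventually.of_forall fun y => ?_)
    rw [Real.norm_of_nonneg (le_min (le_max_right _ _) hA)]
    exact min_le_right _ _
  have hnegI : Integrable (fun y : ℝ => min (max (-y) 0) A) ν := by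
    refine Integrable.of_bound (by fun_prop) A (Eventually.of_forall fun y => ?_)
    rw [Real.norm_of_nonneg (le_min (le_max_right _ _) hA)]
    exact min_le_right _ _
  have hexI : Integrable (fun y : ℝ => max (-y - A) 0) ν :=
    (hint.neg.sub (integrable_const A)).pos_part
  have htI : Integrable (fun y : ℝ => (Ioi (x - A)).indicator (fun _ => (1 : ℝ)) y) ν :=
    (integrable_const _).indicator measurableSet_Ioi
  set H : ℝ := ∫ v in x..(x + L), D v with hH
  have hH0 : 0 ≤ H := integral_nonneg_of_nonneg h0 (by linarith)
  set mp := ∫ y, min (max y 0) A ∂ν with hmp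
  set mn := ∫ y, min (max (-y) 0) A ∂ν with hmn
  have hmp0 : 0 ≤ mp := integral_nonneg fun y => le_min (le_max_right _ _) hA
  have hmn0 : 0 ≤ mn := integral_nonneg fun y => le_min (le_max_right _ _) hA
  -- Pointwise, the jump truncated to `[-A, A]` is at most `y + max (-y - A) 0`, so truncation
  -- raises the drift `-a` by at most `δ`.
  have hdiff : mp - mn ≤ -a + δ := by
    rw [← hmean, hmp, hmn, ← integral_sub hposI hnegI]
    refine (integral_mono (hposI.sub hnegI) (hint.add hexI) (fun y => ?_)).trans
      ((integral_add hint hexI).trans_le (by linarith))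
    simp only [Pi.sub_apply, Pi.add_apply]
    rcases le_total y 0 with h | h
    · rw [max_eq_right h, max_eq_left (by linarith : (0 : ℝ) ≤ -y), min_eq_left hA]
      rcases le_total (-y) A with h' | h'
      · rw [min_eq_left h', max_eq_right (by linarith)]; linarith
      · rw [min_eq_right h', max_eq_left (by linarith)]; linarith
    · rw [max_eq_left h, max_eq_right (by linarith : -y ≤ 0), min_eq_left hA]
      have := min_le_left y A
      have := le_max_right (-y - A) 0
      linarith
  have hsum : mp + mn ≤ M := by
    rw [← hM, hmp, hmn, ← integral_add hposI hnegI]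
    refine integral_mono (hposI.add hnegI) hint.abs fun y => ?_
    have h1 := min_le_left (max y 0) A
    have h2 := min_le_left (max (-y) 0) A
    have h3 : max y 0 + max (-y) 0 = |y| := by
      rcases le_total y 0 with h | h
      · rw [max_eq_right h, max_eq_left (by linarith), abs_of_nonpos h]; ring
      · rw [max_eq_left h, max_eq_right (by linarith), abs_of_nonneg h]; ring
    linarith
  -- A jump beyond `x - A` is charged the trivial bound 1; any other jump lands at a level at least
  -- `A`, where the window estimate applies.
  have hpt : ∀ y, u (x - y) ≤ (Ioi (x - A)).indicator (fun _ => (1 : ℝ)) y +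
      1 / a * (H + min (max y 0) A * (D (x - A) - q) -
        min (max (-y) 0) A * (D (x + A) - q) + J y) := fun y => by
    by_cases hy : y ≤ x - A
    · rw [indicator_of_notMem (by simpa using hy), zero_add]
      refine (huh _ (by linarith)).trans ?_
      exact mul_le_mul_of_nonneg_left (integral_window_le hD h0 hA hx hL hy) (by positivity)
    · push Not at hy
      rw [indicator_of_mem (by simpa using hy)]
      have hy0 : -y ≤ 0 := by linarith
      rw [max_eq_right hy0, min_eq_left hA, zero_mul, sub_zero]
      have h1 : q ≤ D (x - A) := hD (by linarith)
      have h2 : 0 ≤ 1 / a * (H + min (max y 0) A * (D (x - A) - q) + J y) := by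
        refine mul_nonneg (by positivity) (add_nonneg (add_nonneg hH0 (mul_nonneg
          (le_min (le_max_right _ _) hA) (by linarith))) (hJ0 y))
      linarith [hu1 (x - y)]
  have hI1 : Integrable (fun y => H + min (max y 0) A * (D (x - A) - q)) ν :=
    (integrable_const _).add (hposI.mul_const _)
  have hI2 : Integrable (fun y => min (max (-y) 0) A * (D (x + A) - q)) ν := hnegI.mul_const _
  have hI3 : Integrable (fun y => H + min (max y 0) A * (D (x - A) - q) -
      min (max (-y) 0) A * (D (x + A) - q)) ν := hI1.sub hI2
  have hinner : Integrable (fun y => H + min (max y 0) A * (D (x - A) - q) -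
      min (max (-y) 0) A * (D (x + A) - q) + J y) ν := hI3.add hJint
  have hbound : ∫ y, u (x - y) ∂ν ≤ ν.real (Ioi (x - A)) +
      1 / a * (H + mp * (D (x - A) - q) - mn * (D (x + A) - q) +
        ∫ s in A..(x - A), ν.real (Ioi s) * D (x - s)) := by
    have huI : Integrable (fun y => u (x - y)) ν := by
      refine Integrable.of_bound (hu.comp (measurable_id.const_sub x)).aestronglyMeasurable 1
        (Eventually.of_forall fun y => ?_)
      rw [Real.norm_of_nonneg (hu0 _)]
      exact hu1 _
    refine (integral_mono huI (htI.add (hinner.const_mul (1 / a))) hpt).trans_eq ?_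
    rw [integral_add' htI (hinner.const_mul (1 / a)), integral_const_mul,
      integral_indicator_const _ measurableSet_Ioi, smul_eq_mul, mul_one,
      integral_add hI3 hJint, integral_sub hI1 hI2,
      integral_add (integrable_const _) (hposI.mul_const _), integral_mul_const,
      integral_mul_const, integral_integral_indicator hD h0 hx]
    simp [hmp, hmn]

  -- One more unit of horizon lengthens the window by `a ≤ A`, over which `D` hardly drops below
  -- `q`.
  have hnext : H + a * (q - δ * d) ≤ ∫ v in x..(x + (n + 1 : ℕ) * a), D v := by
    have e1 := integral_adjacent hD x (x + L) (x + (n + 1 : ℕ) * a)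
    have e2 : x + (n + 1 : ℕ) * a = x + L + a := by push_cast; ring
    rw [e2] at e1 ⊢
    have b1 := le_integral_of_antitone hD (show x + L ≤ x + L + a by linarith)
    have b2 : D (x + L + A) ≤ D (x + L + a) := hD (by linarith)
    have b3 := hbelow (x + L) (by linarith)
    have b4 : q - δ * d ≤ D (x + L + a) := by nlinarith
    have b5 := mul_le_mul_of_nonneg_left b4 ha.le
    have e5 : (x + L + a - (x + L)) * D (x + L + a) = a * D (x + L + a) := by ring
    linarith
  have hcomb : mp * (D (x - A) - q) - mn * (D (x + A) - q) ≤
      -a * (d - q) + δ * d + δ * d * M := by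
    have b1 : mp * (D (x - A) - q) ≤ mp * ((1 + δ) * d - q) :=
      mul_le_mul_of_nonneg_left (by linarith) hmp0
    have b2 : mn * ((1 - δ) * d - q) ≤ mn * (D (x + A) - q) :=
      mul_le_mul_of_nonneg_left (by linarith) hmn0
    have b3 : (mp - mn) * (d - q) ≤ (-a + δ) * (d - q) :=
      mul_le_mul_of_nonneg_right hdiff (by linarith)
    have b4 : δ * d * (mp + mn) ≤ δ * d * M := mul_le_mul_of_nonneg_left hsum (by positivity)
    have b5 : 0 ≤ δ * q := by positivity
    nlinarith
  refine hbound.trans ?_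
  -- Error budget, in units of `δ * d`: one for the truncated drift, `M` for shifting `D` by `A`,
  -- one for the middle convolution, and `a` for the new piece of window. This is the margin `a *
  -- ((2 + M) / a + 1)` reserved in `htail`.
  have hstep : ν.real (Ioi (x - A)) * a + (H + mp * (D (x - A) - q) - mn * (D (x + A) - q) +
      ∫ s in A..(x - A), ν.real (Ioi s) * D (x - s)) ≤ ∫ v in x..(x + (n + 1 : ℕ) * a), D v := by
    have b1 := mul_le_mul_of_nonneg_right htail ha.le
    have e1 : (1 - δ * ((2 + M) / a + 1)) * d * a = d * a - δ * d * (2 + M) - δ * d * a := by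
      field_simp
      ring
    linarith
  have := mul_le_mul_of_nonneg_left hstep (show 0 ≤ 1 / a by positivity)
  refine le_trans (le_of_eq ?_) this
  field_simp

end Step

/-! ### The supersolution for the fixed-horizon problem -/

lemma tendsto_integral_excess {ν : Measure ℝ} (hint : Integrable (fun y : ℝ => y) ν) :
    Tendsto (fun A : ℝ => ∫ y, max (-y - A) 0 ∂ν) atTop (𝓝 0) := by
  have : Tendsto (fun A : ℝ => ∫ y, max (-y - A) 0 ∂ν) atTop (𝓝 (∫ _, (0 : ℝ) ∂ν)) := by
    refine tendsto_integral_filter_of_dominated_convergence (fun y => |y|)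
      (Eventually.of_forall fun A => by fun_prop) ?_ hint.abs (Eventually.of_forall fun y => ?_)
    · filter_upwards [eventually_ge_atTop 0] with A hA
      refine Eventually.of_forall fun y => ?_
      rw [Real.norm_of_nonneg (le_max_right _ _)]
      exact max_le (by linarith [neg_le_abs y]) (abs_nonneg y)
    · refine tendsto_const_nhds.congr' ?_
      filter_upwards [eventually_ge_atTop (-y)] with A hA
      rw [max_eq_right (by linarith)]
  simpa using this

lemma antitone_integral_window {D : ℝ → ℝ} (hD : Antitone D) {L : ℝ} (hL : 0 ≤ L) :
    Antitone fun x => ∫ v in x..(x + L), D v := fun x y hxy => by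
  have e1 := integral_adjacent hD x (x + L) (y + L)
  have e2 := integral_adjacent hD x y (y + L)
  have := integral_shift_le_of_antitone hD hxy hL
  simp only
  linarith

set_option maxHeartbeats 2000000 in
/-- Bounded functions `u n` that dominate, by induction on the horizon `n`, the probabilities that
a walk with increment law `ν` exceeds a level, and that have the sharp asymptotic upper bound. -/
theorem exists_supersolution {F ν : Measure ℝ} [IsProbabilityMeasure ν]
    (hF : IsStrongSubexponential F) (hFν : ∀ v, 0 ≤ v → ν.real (Ioi v) = tail F v)
    {a : ℝ} (ha : 0 < a) (hint : Integrable (fun y : ℝ => y) ν) (hmean : ∫ y, y ∂ν = -a)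
    {ε : ℝ} (hε : 0 < ε) :
    ∃ u : ℕ → ℝ → ℝ, (∀ n, Measurable (u n)) ∧ (∀ n z, 0 ≤ u n z) ∧ (∀ n z, u n z ≤ 1) ∧
      (∀ n z, z < 0 → u n z = 1) ∧ (∀ n x, 0 ≤ x → ∫ y, u n (x - y) ∂ν ≤ u (n + 1) x) ∧
      ∀ᶠ x in atTop, ∀ n : ℕ, u n x ≤ (1 + ε) * (1 / a * ∫ v in x..(x + n * a), tail F v) := by
  have := hF.isProbabilityMeasure
  set M := ∫ y, |y| ∂ν with hM
  have hM0 : 0 ≤ M := integral_nonneg fun y => abs_nonneg y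
  set κ : ℝ := (2 + M) / a + 1 with hκ
  have hκ1 : 1 ≤ κ := by
    have : 0 ≤ (2 + M) / a := by positivity
    linarith
  set K : ℝ := 1 + ε / 2 with hK
  have hK1 : 1 ≤ K := by linarith
  -- This choice gives `(1 - δ * κ) * K = 1 + δ`: a factor `K` slightly above 1 leaves room for all
  -- errors of one step.
  set δ : ℝ := (ε / 2) / (1 + κ * K) with hδdef
  have hδ : 0 < δ := by positivity
  have hδeq : δ * (1 + κ * K) = ε / 2 := by rw [hδdef]; field_simp
  have hδ1 : δ ≤ 1 := by
    have h1 : K ≤ κ * K := by nlinarith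
    have h2 : δ * K ≤ δ * (κ * K) := mul_le_mul_of_nonneg_left h1 hδ.le
    by_contra h
    push Not at h
    nlinarith
  have hδK : 1 + δ ≤ (1 - δ * κ) * K := by nlinarith
  -- the first scale and level
  have hA : ∀ m : ℝ, 0 < m → ∃ A, a ≤ A ∧ ∫ y, max (-y - A) 0 ∂ν ≤ δ ∧
      ∀ᶠ x in atTop, ∫ y in A..(x - A), tail F y * tail F (x - y) ≤ m * tail F x := fun m hm =>
    ((eventually_ge_atTop a).and (((tendsto_integral_excess hint).eventually
      (ge_mem_nhds hδ)).and (hF.eventually_middle_le hm))).exists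
  have hX : ∀ (A m c : ℝ), (∀ᶠ x in atTop,
      ∫ y in A..(x - A), tail F y * tail F (x - y) ≤ m * tail F x) →
      ∃ x₀, c ≤ x₀ ∧ 2 * A ≤ x₀ ∧ ∀ x, x₀ ≤ x → tail F (x - A) ≤ (1 + δ / 3) * tail F x ∧
        ∫ y in A..(x - A), tail F y * tail F (x - y) ≤ m * tail F x := fun A m c h => by
    obtain ⟨x₀, hx₀⟩ := eventually_atTop.1
      ((hF.eventually_tail_sub_le (show 0 < δ / 3 by positivity) A).and h)
    exact ⟨max x₀ (max c (2 * A)), (le_max_left _ _).trans (le_max_right _ _),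
      (le_max_right _ _).trans (le_max_right _ _), fun x hx => hx₀ x ((le_max_left _ _).trans hx)⟩
  obtain ⟨A, haA, hnegA, hmidA⟩ := hA (δ / 2) (by positivity)
  obtain ⟨x₀, hx₀, hAx₀, hX₀⟩ := hX A _ 0 hmidA
  -- Makes `D (x₀ + a) ≥ 1` once the exponential factor is at least `1 / 2`, so below `x₀` the
  -- candidate is at least 1 and nothing remains to prove.
  set C : ℝ := 2 / tail F (x₀ + a) with hC
  have hC0 : 0 < C := div_pos two_pos (hF.unbounded _)
  -- the second scale and level
  obtain ⟨A₁, haA₁, hnegA₁, hmidA₁⟩ := hA (δ / (K + C)) (by positivity)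
  obtain ⟨x₁, hx₁, hAx₁, hX₁⟩ := hX A₁ _ x₀ hmidA₁
  -- The rate `η` is so small that the exponential has not halved by `x₁ + a` and varies little over
  -- distances `A` and `A₁`.
  obtain ⟨η, hη, hη1, hηA, hηA₁⟩ : ∃ η : ℝ, 0 < η ∧ 1 / 2 ≤ Real.exp (-η * (x₁ + a)) ∧
      Real.exp (η * A) ≤ 1 + δ / 3 ∧ Real.exp (η * A₁) ≤ 1 + δ / 3 := by
    have hlim : ∀ c : ℝ, Tendsto (fun η : ℝ => Real.exp (η * c)) (𝓝[>] 0) (𝓝 1) := fun c => by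
      have : Continuous fun η : ℝ => Real.exp (η * c) := by fun_prop
      simpa using (this.tendsto 0).mono_left nhdsWithin_le_nhds
    have e1 := (hlim (-(x₁ + a))).eventually (le_mem_nhds (show (1 / 2 : ℝ) < 1 by norm_num))
    have e2 := (hlim A).eventually (ge_mem_nhds (show 1 < 1 + δ / 3 by linarith))
    have e3 := (hlim A₁).eventually (ge_mem_nhds (show 1 < 1 + δ / 3 by linarith))
    obtain ⟨η, h1, h2, h3, h4⟩ := (e1.and (e2.and (e3.and self_mem_nhdsWithin))).exists
    exact ⟨η, h4, by rwa [neg_mul_comm], h2, h3⟩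
  set Φ : ℝ → ℝ := fun v => K + C * Real.exp (-η * v) with hΦ
  have hΦK : ∀ v, K ≤ Φ v := fun v => by
    have : 0 ≤ C * Real.exp (-η * v) := by positivity
    simp only [hΦ]; linarith
  have hΦ0 : ∀ v, 0 ≤ Φ v := fun v => by linarith [hΦK v]
  have hΦC : ∀ v, 0 ≤ v → Φ v ≤ K + C := fun v hv => by
    have : Real.exp (-η * v) ≤ 1 := Real.exp_le_one_iff.2 (by nlinarith)
    simp only [hΦ]; nlinarith
  have hΦanti : Antitone Φ := fun v w hvw => by
    have : Real.exp (-η * w) ≤ Real.exp (-η * v) := Real.exp_le_exp.2 (by nlinarith)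
    simp only [hΦ]; nlinarith
  have hΦhalf : ∀ v, v ≤ x₁ + a → K + C / 2 ≤ Φ v := fun v hv => by
    have : Real.exp (-η * (x₁ + a)) ≤ Real.exp (-η * v) := Real.exp_le_exp.2 (by nlinarith)
    simp only [hΦ]; nlinarith
  have hΦshift : ∀ B v, 0 ≤ B → Φ (v - B) ≤ Real.exp (η * B) * Φ v := fun B v hB => by
    have h1 : Real.exp (-η * (v - B)) = Real.exp (η * B) * Real.exp (-η * v) := by
      rw [← Real.exp_add]; ring_nf
    have h2 : 1 ≤ Real.exp (η * B) := Real.one_le_exp (by positivity)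
    simp only [hΦ, h1]; nlinarith
  set D : ℝ → ℝ := fun v => tail F v * Φ v with hDdef
  have hD : Antitone D := fun v w hvw =>
    mul_le_mul (tail_antitone hvw) (hΦanti hvw) (hΦ0 _) (tail_nonneg _)
  have hD0 : ∀ v, 0 ≤ D v := fun v => mul_nonneg (tail_nonneg _) (hΦ0 _)
  have hDK : ∀ v, K * tail F v ≤ D v := fun v => by
    have := mul_le_mul_of_nonneg_left (hΦK v) (tail_nonneg (F := F) v)
    simp only [hDdef]; linarith
  set h : ℕ → ℝ → ℝ := fun n x => 1 / a * ∫ v in x..(x + n * a), D v with hh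
  have hh0 : ∀ n x, 0 ≤ h n x := fun n x => by
    have hna : 0 ≤ (n : ℝ) * a := by positivity
    exact mul_nonneg (by positivity) (integral_nonneg_of_nonneg hD0 (by linarith))
  have hhm : ∀ n, Measurable (h n) := fun n =>
    (antitone_integral_window hD (by positivity)).measurable.const_mul _
  set u : ℕ → ℝ → ℝ := fun n x => if x < 0 then 1 else min 1 (h n x) with hu
  have hum : ∀ n, Measurable (u n) := fun n =>
    Measurable.ite measurableSet_Iio measurable_const (measurable_const.min (hhm n))
  have hu0 : ∀ n z, 0 ≤ u n z := fun n z => by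
    simp only [hu]; split_ifs
    exacts [zero_le_one, le_min zero_le_one (hh0 n z)]
  have hu1 : ∀ n z, u n z ≤ 1 := fun n z => by
    simp only [hu]; split_ifs
    exacts [le_rfl, min_le_left _ _]
  have huh : ∀ n z, 0 ≤ z → u n z ≤ h n z := fun n z hz => by
    simp only [hu, if_neg hz.not_gt]; exact min_le_right _ _
  have hmid : ∀ B x : ℝ, 0 ≤ B → 2 * B ≤ x →
      ∫ s in B..(x - B), ν.real (Ioi s) * D (x - s) ≤
        (K + C) * ∫ s in B..(x - B), tail F s * tail F (x - s) := fun B x hB hx => by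
    have hi1 : IntervalIntegrable (fun s => tail F s * tail F (x - s)) volume B (x - B) := by
      simpa only [mul_comm] using
        IsStrongSubexponential.intervalIntegrable_mul_tail (F := F) x B (x - B)
    have hDi : IntervalIntegrable (fun s => D (x - s)) volume B (x - B) :=
      Monotone.intervalIntegrable fun u v huv => hD (by linarith)
    have hi2 : IntervalIntegrable (fun s => ν.real (Ioi s) * D (x - s)) volume B (x - B) := by
      rw [intervalIntegrable_iff] at hDi ⊢
      refine Integrable.bdd_mul (c := 1) hDi
        (tail_antitone (F := ν)).measurable.aestronglyMeasurable (Eventually.of_forall fun y => ?_)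
      rw [Real.norm_of_nonneg measureReal_nonneg]
      exact measureReal_le_one
    rw [← intervalIntegral.integral_const_mul]
    refine intervalIntegral.integral_mono_on (by linarith) hi2 (hi1.const_mul _) fun s hs => ?_
    rw [hFν s (hB.trans hs.1)]
    have h1 := mul_le_mul_of_nonneg_left (hΦC (x - s) (by linarith [hs.2]))
      (mul_nonneg (tail_nonneg (F := F) s) (tail_nonneg (F := F) (x - s)))
    simp only [hDdef]
    linarith
  have hstep : ∀ (n : ℕ) (B x : ℝ), a ≤ B → 2 * B ≤ x → ∫ y, max (-y - B) 0 ∂ν ≤ δ →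
      (∀ v, x ≤ v → tail F (v - B) ≤ (1 + δ / 3) * tail F v) → Real.exp (η * B) ≤ 1 + δ / 3 →
      (K + C) * (∫ s in B..(x - B), tail F s * tail F (x - s)) ≤ δ * D x →
      ∫ y, u n (x - y) ∂ν ≤ h (n + 1) x := fun n B x haB hBx hneg hsh hexp hm => by
    have hB0 : 0 ≤ B := ha.le.trans haB
    refine integral_step_le hD hD0 ha hint hmean hM.symm hδ haB hBx (fun v hv => ?_) ?_
      ((hmid B x hB0 hBx).trans hm) hneg n (hum n) (hu0 n) (hu1 n)
      fun z hz => huh n z (hB0.trans hz)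
    · have h1 : Φ (v - B) ≤ (1 + δ / 3) * Φ v :=
        (hΦshift B v hB0).trans (mul_le_mul_of_nonneg_right hexp (hΦ0 v))
      have h2 : D (v - B) ≤ ((1 + δ / 3) * tail F v) * ((1 + δ / 3) * Φ v) :=
        mul_le_mul (hsh v hv) h1 (hΦ0 _) (mul_nonneg (by linarith) (tail_nonneg _))
      have h3 : ((1 + δ / 3) * tail F v) * ((1 + δ / 3) * Φ v) =
          ((1 + δ / 3) * (1 + δ / 3)) * D v := by simp only [hDdef]; ring
      rw [h3] at h2
      exact h2.trans (mul_le_mul_of_nonneg_right (by nlinarith) (hD0 v))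
    · rw [hFν _ (by linarith)]
      have h1 := hsh x le_rfl
      have h2 := tail_nonneg (F := F) x
      have h3 := hDK x
      have h4 : 0 < 1 - δ * κ := by
        by_contra hcon
        push Not at hcon
        nlinarith
      calc tail F (x - B) ≤ (1 + δ) * tail F x := by nlinarith
        _ ≤ (1 - δ * κ) * K * tail F x := mul_le_mul_of_nonneg_right hδK h2
        _ ≤ (1 - δ * κ) * D x := by
          rw [mul_assoc]; exact mul_le_mul_of_nonneg_left h3 h4.le
  refine ⟨u, hum, hu0, hu1, fun n z hz => if_pos hz, fun n x hx => ?_, ?_⟩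
  · have htriv : ∫ y, u n (x - y) ∂ν ≤ 1 := by
      have := norm_integral_le_of_norm_le_const (μ := ν) (f := fun y => u n (x - y)) (C := 1)
        (Eventually.of_forall fun y => by rw [Real.norm_of_nonneg (hu0 _ _)]; exact hu1 _ _)
      rw [probReal_univ, mul_one] at this
      exact (le_abs_self _).trans this
    have hgoal : u (n + 1) x = min 1 (h (n + 1) x) := if_neg hx.not_gt
    rw [hgoal]
    refine le_min htriv ?_
    rcases lt_or_ge x x₀ with hxx | hxx
    · refine htriv.trans ?_
      have e1 := integral_adjacent hD x (x + a) (x + (n + 1 : ℕ) * a)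
      have b1 := le_integral_of_antitone hD (show x ≤ x + a by linarith)
      have b2 : 0 ≤ ∫ v in (x + a)..(x + (n + 1 : ℕ) * a), D v :=
        integral_nonneg_of_nonneg hD0 (by push_cast; nlinarith [show 0 ≤ (n : ℝ) * a by positivity])
      have b3 : D (x₀ + a) ≤ D (x + a) := hD (by linarith)
      have b4 : 1 ≤ D (x₀ + a) := by
        have h1 := mul_le_mul_of_nonneg_left (hΦhalf (x₀ + a) (by linarith))
          (tail_nonneg (F := F) (x₀ + a))
        have h2 : tail F (x₀ + a) * C = 2 := by
          rw [hC]; field_simp [(hF.unbounded (x₀ + a)).ne']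
        have h3 := tail_nonneg (F := F) (x₀ + a)
        simp only [hDdef]
        nlinarith
      have b5 : a ≤ ∫ v in x..(x + (n + 1 : ℕ) * a), D v := by nlinarith
      have b6 := mul_le_mul_of_nonneg_left b5 (show 0 ≤ 1 / a by positivity)
      rwa [one_div_mul_cancel ha.ne'] at b6
    · rcases le_or_gt x x₁ with hxx₁ | hxx₁
      · refine hstep n A x haA (hAx₀.trans hxx) hnegA (fun v hv => (hX₀ v (hxx.trans hv)).1) hηA ?_
        have h1 := (hX₀ x hxx).2
        have h2 := mul_le_mul_of_nonneg_left (hΦhalf x (by linarith)) (tail_nonneg (F := F) x)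
        have h3 := mul_le_mul_of_nonneg_left h1 (show 0 ≤ K + C by positivity)
        have h4 := mul_le_mul_of_nonneg_left h2 hδ.le
        have h5 : 0 ≤ δ * tail F x * K := by have := tail_nonneg (F := F) x; positivity
        simp only [hDdef]
        linarith
      · refine hstep n A₁ x haA₁ (hAx₁.trans hxx₁.le) hnegA₁
          (fun v hv => (hX₁ v (hxx₁.le.trans hv)).1) hηA₁ ?_
        have h3 := mul_le_mul_of_nonneg_left (hX₁ x hxx₁.le).2 (show 0 ≤ K + C by positivity)
        refine h3.trans ?_
        have h4 : (K + C) * (δ / (K + C) * tail F x) = δ * tail F x := by field_simp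
        rw [h4]
        have h5 := hDK x
        have h6 := tail_nonneg (F := F) x
        exact mul_le_mul_of_nonneg_left (by nlinarith) hδ.le
  -- The boundary correction `C * exp (-η x)` dies out, leaving the factor `K + ε / 2 = 1 + ε`.
  · have hlim : Tendsto (fun x => C * Real.exp (-η * x)) atTop (𝓝 0) := by
      have h1 : Tendsto (fun x : ℝ => Real.exp (-η * x)) atTop (𝓝 0) :=
        Real.tendsto_exp_atBot.comp (tendsto_id.const_mul_atTop_of_neg (by linarith))
      simpa using h1.const_mul C
    filter_upwards [hlim.eventually (ge_mem_nhds (show 0 < ε / 2 by positivity)),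
      eventually_ge_atTop 0] with x hx hx0 n
    refine (huh n x hx0).trans ?_
    rw [mul_left_comm]
    refine mul_le_mul_of_nonneg_left ?_ (by positivity)
    rw [← intervalIntegral.integral_const_mul]
    have hna : 0 ≤ (n : ℝ) * a := by positivity
    refine intervalIntegral.integral_mono_on (by linarith) hD.intervalIntegrable
      (tail_antitone.intervalIntegrable.const_mul _) fun v hv => ?_
    have h1 : Φ v ≤ 1 + ε := (hΦanti hv.1).trans (by simp only [hΦ]; linarith)
    have := mul_le_mul_of_nonneg_left h1 (tail_nonneg (F := F) v)
    simp only [hDdef]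
    linarith

/-! ### Fixed-horizon maxima of random walks with negative drift -/

section Walk

variable {Ω : Type*} {X : ℕ → Ω → ℝ}

lemma epoch_zero (ω : Ω) : epoch X 0 ω = 0 := by simp [epoch]

lemma epoch_succ (n : ℕ) (ω : Ω) : epoch X (n + 1) ω = epoch X n ω + X n ω := by
  simp [epoch, Finset.sum_range_succ]

variable [MeasurableSpace Ω] {μ : Measure Ω}

lemma measurable_epoch (hX : ∀ n, Measurable (X n)) (n : ℕ) : Measurable (epoch X n) :=
  Finset.measurable_sum _ fun i _ => hX i

lemma measurable_stopped_epoch (hX : ∀ n, Measurable (X n)) (k : ℕ) :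
    Measurable fun ω (j : ℕ) => epoch X (min j k) ω :=
  measurable_pi_lambda _ fun j => measurable_epoch hX (min j k)

/-- The path frozen at time `k` is a function of the first `k` increments only; it serves as the
past of the walk. -/
lemma indepFun_stopped_epoch (hX : ∀ n, Measurable (X n)) (h : iIndepFun X μ) (k : ℕ) :
    IndepFun (fun ω (j : ℕ) => epoch X (min j k) ω) (X k) μ := by
  have h1 := h.indepFun_finset (Finset.range k) {k} (by simp) hX
  let φ : (Finset.range k → ℝ) → ℕ → ℝ := fun w j =>
    ∑ i ∈ Finset.range (min j k), if hi : i ∈ Finset.range k then w ⟨i, hi⟩ else 0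
  have hφ : Measurable φ := by
    refine measurable_pi_lambda _ fun j => Finset.measurable_sum _ fun i _ => ?_
    split_ifs with hi
    · exact measurable_pi_apply _
    · exact measurable_const
  have hψ : Measurable fun w : ({k} : Finset ℕ) → ℝ => w ⟨k, by simp⟩ := measurable_pi_apply _
  have h2 := h1.comp hφ hψ
  have hW : (fun ω (j : ℕ) => epoch X (min j k) ω) =
      φ ∘ fun ω (i : Finset.range k) => X i ω := by
    ext ω j
    simp only [Function.comp_apply, φ, epoch]
    refine Finset.sum_congr rfl fun i hi => ?_
    have : i < k := by simp only [Finset.mem_range, lt_min_iff] at hi; exact hi.2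
    simp [this]
  rw [hW]
  exact h2

lemma measurableSet_exceed (hX : ∀ n, Measurable (X n)) (n : ℕ) (x : ℝ) :
    MeasurableSet {ω | ∃ k ≤ n, x < epoch X k ω} := by
  have : {ω | ∃ k ≤ n, x < epoch X k ω} = ⋃ k ∈ Iic n, {ω | x < epoch X k ω} := by
    ext; simp
  rw [this]
  exact MeasurableSet.biUnion (to_countable _) fun k _ =>
    measurableSet_lt measurable_const (measurable_epoch hX k)

/-- A supermartingale argument. `V k m` is the value after `k` steps with `m` left: 1 if the level
has been passed, else `u m` at the remaining distance. Its mean does not increase along `k + m = n`;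
it starts at `u n x` and ends above the exceedance indicator. -/
lemma measureReal_exceed_le [IsProbabilityMeasure μ] (hX : ∀ n, Measurable (X n))
    (hind : iIndepFun X μ) {ν : Measure ℝ} (hν : ∀ n, μ.map (X n) = ν) {u : ℕ → ℝ → ℝ}
    (hum : ∀ n, Measurable (u n)) (hu0 : ∀ n z, 0 ≤ u n z) (hu1 : ∀ n z, u n z ≤ 1)
    (huneg : ∀ n z, z < 0 → u n z = 1)
    (hstep : ∀ n x, 0 ≤ x → ∫ y, u n (x - y) ∂ν ≤ u (n + 1) x) {x : ℝ} (hx : 0 ≤ x) (n : ℕ) :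
    μ.real {ω | ∃ k ≤ n, x < epoch X k ω} ≤ u n x := by
  classical
  have : IsProbabilityMeasure ν := hν 0 ▸ Measure.isProbabilityMeasure_map (hX 0).aemeasurable
  set P : ℕ → Set (ℕ → ℝ) := fun k => {s | ∃ j ≤ k, x < s j} with hP
  have hPm : ∀ k, MeasurableSet (P k) := fun k => by
    have : P k = ⋃ j ∈ Iic k, {s : ℕ → ℝ | x < s j} := by ext; simp [hP]
    rw [this]
    exact MeasurableSet.biUnion (to_countable _) fun j _ =>
      measurableSet_lt measurable_const (measurable_pi_apply j)
  set V : ℕ → ℕ → Ω → ℝ := fun k m ω =>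
    if ∃ j ≤ k, x < epoch X j ω then 1 else u m (x - epoch X k ω) with hV
  have hV0 : ∀ k m ω, 0 ≤ V k m ω := fun k m ω => by
    simp only [hV]; split_ifs
    exacts [zero_le_one, hu0 _ _]
  have hV1 : ∀ k m ω, V k m ω ≤ 1 := fun k m ω => by
    simp only [hV]; split_ifs
    exacts [le_rfl, hu1 _ _]
  have hVm : ∀ k m, Measurable (V k m) := fun k m =>
    Measurable.ite (measurableSet_exceed hX k x) measurable_const
      ((hum m).comp ((measurable_epoch hX k).const_sub x))
  have hVi : ∀ k m, Integrable (V k m) μ := fun k m =>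
    Integrable.of_bound (hVm k m).aestronglyMeasurable 1 (Eventually.of_forall fun ω => by
      rw [Real.norm_of_nonneg (hV0 _ _ _)]; exact hV1 _ _ _)
  have hdec : ∀ k m, ∫ ω, V (k + 1) m ω ∂μ ≤ ∫ ω, V k (m + 1) ω ∂μ := fun k m => by
    set W : Ω → ℕ → ℝ := fun ω j => epoch X (min j k) ω with hW
    have hWm : Measurable W := measurable_stopped_epoch hX k
    set G : (ℕ → ℝ) × ℝ → ℝ := fun p => if p.1 ∈ P k then 1 else u m (x - p.1 k - p.2) with hG
    have hWP : ∀ ω, W ω ∈ P k ↔ ∃ j ≤ k, x < epoch X j ω := fun ω => by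
      simp only [hP, hW, mem_ofPred_eq]
      refine exists_congr fun j => and_congr_right fun hj => ?_
      rw [min_eq_left hj]
    have hGm : Measurable G := by
      refine Measurable.ite (measurable_fst (hPm k)) measurable_const ((hum m).comp ?_)
      have h1 : Measurable fun p : (ℕ → ℝ) × ℝ => p.1 k := (measurable_pi_apply k).comp measurable_fst
      exact (h1.const_sub x).sub measurable_snd
    have hG1 : ∀ p, ‖G p‖ ≤ 1 := fun p => by
      simp only [hG]; split_ifs
      · simp
      · rw [Real.norm_of_nonneg (hu0 _ _)]; exact hu1 _ _
    have hVG : ∀ ω, V (k + 1) m ω = G (W ω, X k ω) := fun ω => by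
      have hWk : W ω k = epoch X k ω := by simp [hW]
      simp only [hV, hG, hWP, hWk]
      by_cases h1 : ∃ j ≤ k, x < epoch X j ω
      · rw [if_pos h1, if_pos]
        obtain ⟨j, hj, hxj⟩ := h1
        exact ⟨j, by omega, hxj⟩
      · rw [if_neg h1, epoch_succ, sub_sub]
        split_ifs with h2
        · obtain ⟨j, hj, hxj⟩ := h2
          rcases Nat.lt_or_ge k j with hkj | hkj
          · obtain rfl : j = k + 1 := by omega
            -- If the passage happens exactly at step `k + 1`, the remaining distance is negative,
            -- where `u` equals 1.
            rw [huneg _ _ (by rw [epoch_succ] at hxj; linarith)]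
          · exact absurd ⟨j, hkj, hxj⟩ h1
        · rfl
    have hmap := (indepFun_stopped_epoch hX hind k).map_prod_eq_prod_map_map hWm.aemeasurable
      (hX k).aemeasurable
    rw [hν k] at hmap
    have := Measure.isProbabilityMeasure_map (μ := μ) hWm.aemeasurable
    have hGi : Integrable G ((μ.map W).prod ν) :=
      Integrable.of_bound hGm.aestronglyMeasurable 1 (Eventually.of_forall hG1)
    calc ∫ ω, V (k + 1) m ω ∂μ = ∫ ω, G (W ω, X k ω) ∂μ := by simp only [hVG]
      _ = ∫ p, G p ∂((μ.map W).prod ν) := by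
        rw [← hmap, integral_map (hWm.prodMk (hX k)).aemeasurable hGm.aestronglyMeasurable]
      _ = ∫ s, (∫ y, G (s, y) ∂ν) ∂(μ.map W) := integral_prod _ hGi
      _ = ∫ ω, (∫ y, G (W ω, y) ∂ν) ∂μ :=
        integral_map hWm.aemeasurable hGi.integral_prod_left.aestronglyMeasurable
      _ ≤ ∫ ω, V k (m + 1) ω ∂μ := by
        refine integral_mono (hGi.integral_prod_left.comp_measurable hWm) (hVi _ _) fun ω => ?_
        have hWk : W ω k = epoch X k ω := by simp [hW]
        simp only [hG, hV, hWP, hWk]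
        split_ifs with h1
        · simp
        · push Not at h1
          exact hstep m _ (sub_nonneg.2 (h1 k le_rfl))
  have hall : ∀ k m, ∫ ω, V k m ω ∂μ ≤ u (m + k) x := fun k => by
    induction k with
    | zero =>
      intro m
      have : ∀ ω, V 0 m ω = u m x := fun ω => by
        simp [hV, epoch_zero, hx.not_gt]
      simp [this]
    | succ k ih =>
      intro m
      refine (hdec k m).trans ((ih (m + 1)).trans_eq ?_)
      congr 1
      omega
  have h1 := hall n 0
  rw [zero_add] at h1
  refine le_trans ?_ h1
  rw [← integral_indicator_one (measurableSet_exceed hX n x)]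
  refine integral_mono ((integrable_const _).indicator (measurableSet_exceed hX n x))
    (hVi n 0) fun ω => ?_
  by_cases h : ∃ k ≤ n, x < epoch X k ω
  · rw [indicator_of_mem (show ω ∈ {ω | ∃ k ≤ n, x < epoch X k ω} from h)]
    simp [hV, h]
  · rw [indicator_of_notMem (show ω ∉ {ω | ∃ k ≤ n, x < epoch X k ω} from h)]
    exact hV0 _ _ _

lemma ae_tendsto_epoch_div (hind : iIndepFun X μ) (hid : ∀ n, IdentDistrib (X n) (X 0) μ μ)
    (hint : Integrable (X 0) μ) :
    ∀ᵐ ω ∂μ, Tendsto (fun n : ℕ => epoch X n ω / n) atTop (𝓝 (∫ ω, X 0 ω ∂μ)) :=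
  strong_law_ae_real X hint (fun _ _ hij => hind.indepFun hij) hid

/-- By the strong law, almost every path lies in the corridor for some `R`; these events increase
with `R`. -/
lemma exists_corridor [IsProbabilityMeasure μ] (hX : ∀ n, Measurable (X n))
    (hind : iIndepFun X μ) (hid : ∀ n, IdentDistrib (X n) (X 0) μ μ)
    (hint : Integrable (X 0) μ) {a c : ℝ} (ha : 0 < a) (hac : a < c)
    (hmean : ∫ ω, X 0 ω ∂μ = -a) {ε : ℝ} (hε : 0 < ε) :
    ∃ R : ℝ, 0 ≤ R ∧ 1 - ε ≤ μ.real {ω | ∀ n : ℕ, epoch X n ω ≤ R ∧ -(c * n) - R ≤ epoch X n ω} := by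
  set E : ℕ → Set Ω := fun R => {ω | ∀ n : ℕ, epoch X n ω ≤ R ∧ -(c * n) - R ≤ epoch X n ω} with hE
  have hmono : Monotone E := fun R R' h ω hω n => by
    have h' : (R : ℝ) ≤ R' := by exact_mod_cast h
    exact ⟨(hω n).1.trans h', by linarith [(hω n).2]⟩
  have hfull : ∀ᵐ ω ∂μ, ω ∈ ⋃ R, E R := by
    filter_upwards [ae_tendsto_epoch_div hind hid hint] with ω hω
    rw [hmean] at hω
    have hup : BddAbove (range fun n : ℕ => epoch X n ω) := by
      refine IsBoundedUnder.bddAbove_range ⟨0, ?_⟩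
      rw [eventually_map]
      filter_upwards [hω.eventually (gt_mem_nhds (show -a < 0 by linarith)),
        eventually_gt_atTop 0] with n hn hn0
      have hn0' : (0 : ℝ) < n := by exact_mod_cast hn0
      rw [div_lt_iff₀ hn0', zero_mul] at hn
      exact hn.le
    have hlow : BddAbove (range fun n : ℕ => -(c * n) - epoch X n ω) := by
      refine IsBoundedUnder.bddAbove_range ⟨0, ?_⟩
      rw [eventually_map]
      filter_upwards [hω.eventually (lt_mem_nhds (show -c < -a by linarith)),
        eventually_gt_atTop 0] with n hn hn0
      have hn0' : (0 : ℝ) < n := by exact_mod_cast hn0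
      rw [lt_div_iff₀ hn0'] at hn
      linarith
    obtain ⟨r1, hr1⟩ := hup
    obtain ⟨r2, hr2⟩ := hlow
    obtain ⟨R, hR⟩ := exists_nat_ge (max r1 r2)
    refine mem_iUnion.2 ⟨R, fun n => ⟨?_, ?_⟩⟩
    · exact (hr1 ⟨n, rfl⟩).trans ((le_max_left _ _).trans hR)
    · have := (hr2 ⟨n, rfl⟩).trans ((le_max_right _ _).trans hR)
      simp only at this
      linarith
  have hlim := tendsto_measure_iUnion_atTop (μ := μ) hmono
  have h1 : μ (⋃ R, E R) = 1 := prob_compl_eq_zero_iff₀ (by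
    refine NullMeasurableSet.iUnion fun R => MeasurableSet.nullMeasurableSet ?_
    simp only [hE, ofPred_forall]
    refine MeasurableSet.iInter fun n => (measurableSet_le (measurable_epoch hX n)
      measurable_const).inter (measurableSet_le measurable_const (measurable_epoch hX n))) |>.1 hfull
  rw [h1] at hlim
  have hlim' : Tendsto (fun R => μ.real (E R)) atTop (𝓝 1) := by
    have := (ENNReal.tendsto_toReal ENNReal.one_ne_top).comp hlim
    rwa [ENNReal.toReal_one] at this
  obtain ⟨R, hR⟩ := (hlim'.eventually (lt_mem_nhds (show 1 - ε < 1 by linarith))).exists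
  exact ⟨R, Nat.cast_nonneg R, hR.le⟩

/-- From a position at least `-r`, a jump above `x + r` crosses `x`. The jump is independent of the
past, and a first crossing at step `n + 1` is disjoint from earlier ones. -/
lemma add_le_measureReal_exceed_succ [IsProbabilityMeasure μ] (hX : ∀ n, Measurable (X n))
    (hind : iIndepFun X μ) {ν : Measure ℝ} (hν : ∀ n, μ.map (X n) = ν) (n : ℕ) (x r : ℝ) :
    μ.real {ω | ∃ k ≤ n, x < epoch X k ω} +
      μ.real {ω | (∀ k ≤ n, epoch X k ω ≤ x) ∧ -r ≤ epoch X n ω} * ν.real (Ioi (x + r)) ≤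
      μ.real {ω | ∃ k ≤ n + 1, x < epoch X k ω} := by
  set W : Ω → ℕ → ℝ := fun ω j => epoch X (min j n) ω with hW
  set Q : Set (ℕ → ℝ) := {s | (∀ k ≤ n, s k ≤ x) ∧ -r ≤ s n} with hQ
  have hQm : MeasurableSet Q := by
    have : Q = (⋂ k ∈ Iic n, {s : ℕ → ℝ | s k ≤ x}) ∩ {s | -r ≤ s n} := by ext; simp [hQ]
    rw [this]
    exact (MeasurableSet.biInter (to_countable _) fun j _ =>
      measurableSet_le (measurable_pi_apply j) measurable_const).inter
      (measurableSet_le measurable_const (measurable_pi_apply n))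
  have hWQ : {ω | (∀ k ≤ n, epoch X k ω ≤ x) ∧ -r ≤ epoch X n ω} = W ⁻¹' Q := by
    ext ω
    simp only [hQ, hW, mem_preimage, mem_ofPred_eq, min_self]
    refine and_congr_left fun _ => forall_congr' fun k => imp_congr_right fun hk => ?_
    rw [min_eq_left hk]
  have hmul := (indepFun_stopped_epoch hX hind n).measure_inter_preimage_eq_mul Q (Ioi (x + r))
    hQm measurableSet_Ioi
  have hmul' : μ.real (W ⁻¹' Q ∩ X n ⁻¹' Ioi (x + r)) = μ.real (W ⁻¹' Q) * ν.real (Ioi (x + r)) := by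
    rw [← hν n, map_measureReal_apply (hX n) measurableSet_Ioi]
    simp only [Measure.real, ← ENNReal.toReal_mul, ← hmul, hW]
  rw [hWQ, ← hmul', ← measureReal_union]
  · refine measureReal_mono ?_
    rintro ω (⟨k, hk, hxk⟩ | ⟨h1, h2⟩)
    · exact ⟨k, by omega, hxk⟩
    · refine ⟨n + 1, le_rfl, ?_⟩
      have h3 := h1.2
      simp only [hW, min_self] at h3
      have h4 : x + r < X n ω := h2
      rw [epoch_succ]
      linarith
  · rw [Set.disjoint_left]
    rintro ω ⟨k, hk, hxk⟩ ⟨h1, _⟩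
    have := h1.1 k hk
    simp only [hW, min_eq_left hk] at this
    linarith
  · exact ((measurable_stopped_epoch hX n) hQm).inter ((hX n) measurableSet_Ioi)

theorem eventually_le_measureReal_exceed [IsProbabilityMeasure μ] (hX : ∀ n, Measurable (X n))
    (hind : iIndepFun X μ) (hid : ∀ n, IdentDistrib (X n) (X 0) μ μ)
    (hint : Integrable (X 0) μ) {F : Measure ℝ} (hF : IsStrongSubexponential F)
    (hFν : ∀ v, 0 ≤ v → (μ.map (X 0)).real (Ioi v) = tail F v) {a : ℝ} (ha : 0 < a)
    (hmean : ∫ ω, X 0 ω ∂μ = -a) {ε : ℝ} (hε : 0 < ε) (hε1 : ε < 1) :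
    ∀ᶠ x in atTop, ∀ n : ℕ, (1 - ε) * (1 / a * ∫ v in x..(x + n * a), tail F v) ≤
      μ.real {ω | ∃ k ≤ n, x < epoch X k ω} := by
  have := hF.isProbabilityMeasure
  have hν : ∀ n, μ.map (X n) = μ.map (X 0) := fun n => (hid n).map_eq
  -- Three losses of relative size `e` occur: the corridor slope, the shift by `R`, and the corridor
  -- probability. They fit since `(1 - ε) * (1 + e)^2 ≤ 1 - e`.
  set e : ℝ := ε / 4 with he
  have he0 : 0 < e := by positivity
  set c : ℝ := (1 + e) * a with hc
  have hc0 : 0 < c := by positivity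
  have hac : a < c := by nlinarith
  obtain ⟨R, hR0, hR⟩ := exists_corridor hX hind hid hint ha hac hmean he0
  obtain ⟨x₀, hx₀⟩ := eventually_atTop.1 (hF.eventually_tail_sub_le he0 R)
  filter_upwards [eventually_ge_atTop x₀, eventually_ge_atTop R] with x hx hxR n
  have hx0 : 0 ≤ x := hR0.trans hxR
  have hshift : ∀ v, x ≤ v → tail F v ≤ (1 + e) * tail F (v + R) := fun v hv => by
    have := hx₀ (v + R) (by linarith)
    rwa [add_sub_cancel_right] at this
  have hind' : ∀ n : ℕ, (1 - e) * ∫ v in x..(x + n * c), tail F v ≤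
      (1 + e) * c * μ.real {ω | ∃ k ≤ n, x < epoch X k ω} := fun n => by
    induction n with
    | zero =>
      have : 0 ≤ μ.real {ω | ∃ k ≤ 0, x < epoch X k ω} := measureReal_nonneg
      simp only [Nat.cast_zero, zero_mul, add_zero, intervalIntegral.integral_same, mul_zero]
      positivity
    | succ n ih =>
      have hnc : 0 ≤ n * c := by positivity
      have h1 := add_le_measureReal_exceed_succ hX hind hν n x (c * n + R)
      rw [hFν _ (by linarith)] at h1
      have h2 : 1 - e ≤ μ.real {ω | (∀ k ≤ n, epoch X k ω ≤ x) ∧ -(c * n + R) ≤ epoch X n ω} := by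
        refine hR.trans (measureReal_mono fun ω hω => ⟨fun k _ => (hω k).1.trans hxR, ?_⟩)
        linarith [(hω n).2]
      have h3 := mul_le_mul_of_nonneg_right h2 (tail_nonneg (F := F) (x + (c * n + R)))
      have h4 := hshift (x + n * c) (by linarith)
      have h5 := integral_adjacent (tail_antitone (F := F)) x (x + n * c) (x + (n + 1 : ℕ) * c)
      have h6 := integral_le_of_antitone (tail_antitone (F := F))
        (show x + n * c ≤ x + (n + 1 : ℕ) * c by push_cast; linarith)
      rw [show x + ((n + 1 : ℕ) : ℝ) * c - (x + n * c) = c by push_cast; ring] at h6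
      rw [show x + n * c + R = x + (c * n + R) by ring] at h4
      rw [← h5, mul_add]
      have h7 : (1 - e) * (∫ v in (x + n * c)..(x + (n + 1 : ℕ) * c), tail F v) ≤
          (1 + e) * c * ((1 - e) * tail F (x + (c * n + R))) := by
        have h8 := mul_le_mul_of_nonneg_left h4 hc0.le
        have h9 := mul_le_mul_of_nonneg_left (h6.trans h8) (show 0 ≤ 1 - e by linarith)
        linarith
      have h10 := mul_le_mul_of_nonneg_left (h3.trans (le_sub_iff_add_le'.2 h1))
        (show 0 ≤ (1 + e) * c by positivity)
      linarith
  have h1 := hind' n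
  have hna : 0 ≤ (n : ℝ) * a := by positivity
  have hnac : (n : ℝ) * a ≤ n * c := mul_le_mul_of_nonneg_left hac.le (Nat.cast_nonneg n)
  have h2 : ∫ v in x..(x + n * a), tail F v ≤ ∫ v in x..(x + n * c), tail F v := by
    rw [← integral_adjacent tail_antitone x (x + n * a) (x + n * c)]
    linarith [integral_nonneg_of_nonneg (D := tail F) (fun v => tail_nonneg v)
      (show x + n * a ≤ x + n * c by linarith)]
  have h3 := (mul_le_mul_of_nonneg_left h2 (show 0 ≤ 1 - e by linarith)).trans h1
  set I := ∫ v in x..(x + n * a), tail F v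
  have hI : 0 ≤ I := integral_nonneg_of_nonneg (fun v => tail_nonneg v) (by linarith)
  have h4 : (1 - ε) * ((1 + e) * (1 + e)) ≤ 1 - e := by
    rw [show ε = 4 * e by rw [he]; ring]
    nlinarith [sq_nonneg e, mul_pos he0 (mul_pos he0 he0)]
  have h5 := mul_le_mul_of_nonneg_right h4 hI
  have h6 : ((1 + e) * (1 + e)) * ((1 - ε) * I) ≤
      ((1 + e) * (1 + e)) * (a * μ.real {ω | ∃ k ≤ n, x < epoch X k ω}) := by
    rw [hc] at h3
    linarith
  have h7 := le_of_mul_le_mul_left h6 (by positivity)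
  rw [mul_left_comm, one_div_mul_eq_div, div_le_iff₀ ha]
  linarith

theorem eventually_measureReal_exceed_le [IsProbabilityMeasure μ] (hX : ∀ n, Measurable (X n))
    (hind : iIndepFun X μ) (hid : ∀ n, IdentDistrib (X n) (X 0) μ μ)
    (hint : Integrable (X 0) μ) {F : Measure ℝ} (hF : IsStrongSubexponential F)
    (hFν : ∀ v, 0 ≤ v → (μ.map (X 0)).real (Ioi v) = tail F v) {a : ℝ} (ha : 0 < a)
    (hmean : ∫ ω, X 0 ω ∂μ = -a) {ε : ℝ} (hε : 0 < ε) :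
    ∀ᶠ x in atTop, ∀ n : ℕ, μ.real {ω | ∃ k ≤ n, x < epoch X k ω} ≤
      (1 + ε) * (1 / a * ∫ v in x..(x + n * a), tail F v) := by
  have := Measure.isProbabilityMeasure_map (μ := μ) (hX 0).aemeasurable
  obtain ⟨u, hum, hu0, hu1, huneg, hstep, hu⟩ := exists_supersolution (ν := μ.map (X 0)) hF hFν ha
    ((integrable_map_measure measurable_id.aestronglyMeasurable (hX 0).aemeasurable).2 hint)
    (by rw [integral_map (hX 0).aemeasurable measurable_id'.aestronglyMeasurable, hmean]) hε
  filter_upwards [hu, eventually_ge_atTop 0] with x hx hx0 n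
  exact (measureReal_exceed_le hX hind (fun n => (hid n).map_eq) hum hu0 hu1 huneg hstep hx0 n).trans
    (hx n)

end Walk

/-! ### Means of natural-valued variables as sums of tails -/

section NatValued

variable {Ω : Type*} [MeasurableSpace Ω] {μ : Measure Ω} [IsProbabilityMeasure μ]

lemma integrable_and_integral_natCast {N : Ω → ℕ} (hN : Measurable N)
    (hs : Summable fun n => μ.real {ω | n < N ω}) :
    Integrable (fun ω => (N ω : ℝ)) μ ∧ ∫ ω, (N ω : ℝ) ∂μ = ∑' n, μ.real {ω | n < N ω} := by
  have hset : ∀ n, MeasurableSet {ω | n < N ω} := fun n => measurableSet_lt measurable_const hN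
  have hpt : ∀ ω, ENNReal.ofReal (N ω : ℝ) =
      ∑' n, {ω | n < N ω}.indicator (fun _ => (1 : ENNReal)) ω := fun ω => by
    rw [tsum_eq_sum (s := Finset.range (N ω))]
    · rw [Finset.sum_congr rfl fun n hn => indicator_of_mem
        (show ω ∈ {ω | n < N ω} from Finset.mem_range.1 hn) _]
      simp
    · intro n hn
      exact indicator_of_notMem (show ω ∉ {ω | n < N ω} from fun h => hn (Finset.mem_range.2 h)) _
  have hl : ∫⁻ ω, ENNReal.ofReal (N ω : ℝ) ∂μ = ENNReal.ofReal (∑' n, μ.real {ω | n < N ω}) := by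
    rw [ENNReal.ofReal_tsum_of_nonneg (fun _ => measureReal_nonneg) hs]
    simp only [hpt]
    rw [lintegral_tsum fun n => (measurable_const.indicator (hset n)).aemeasurable]
    refine tsum_congr fun n => ?_
    rw [lintegral_indicator_const (hset n), one_mul, ofReal_measureReal]
  have hm : AEStronglyMeasurable (fun ω => (N ω : ℝ)) μ :=
    (measurable_from_nat.comp hN).aestronglyMeasurable
  have h0 : 0 ≤ᵐ[μ] fun ω => (N ω : ℝ) := Eventually.of_forall fun ω => Nat.cast_nonneg _
  refine ⟨⟨hm, ?_⟩, ?_⟩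
  · rw [hasFiniteIntegral_iff_ofReal h0, hl]
    exact ENNReal.ofReal_lt_top
  · rw [integral_eq_lintegral_of_nonneg_ae h0 hm, hl,
      ENNReal.toReal_ofReal (tsum_nonneg fun _ => measureReal_nonneg)]

lemma integral_min_natCast {N : Ω → ℕ} (hN : Measurable N) (J : ℕ) :
    ∫ ω, ((min (N ω) J : ℕ) : ℝ) ∂μ = ∑ n ∈ Finset.range J, μ.real {ω | n < N ω} := by
  have hz : ∀ n ∉ Finset.range J, μ.real {ω | n < min (N ω) J} = 0 := fun n hn => by
    have : {ω | n < min (N ω) J} = ∅ := by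
      ext ω
      simp only [Finset.mem_range] at hn
      simp only [lt_min_iff, mem_ofPred_eq, mem_empty_iff_false]
      tauto
    rw [this, measureReal_empty]
  rw [(integrable_and_integral_natCast (hN.min measurable_const)
    (summable_of_ne_finset_zero hz)).2, tsum_eq_sum hz]
  refine Finset.sum_congr rfl fun n hn => ?_
  congr 1
  ext ω
  simp only [lt_min_iff, mem_ofPred_eq]
  exact ⟨fun h => h.1, fun h => ⟨h, Finset.mem_range.1 hn⟩⟩

end NatValued

/-! ### The counting variable -/

section Count

/-- Divergence makes the set finite, namely `Ico 1 k` with `k` the first index past `t`; without it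
`ncard` could take its default value 0. -/
lemma le_ncard_iff_of_strictMono {T : ℕ → ℝ} (h0 : T 0 = 0) (hT : StrictMono T)
    (hlim : Tendsto T atTop atTop) {t : ℝ} (ht : 0 ≤ t) (n : ℕ) :
    n ≤ {k : ℕ | 1 ≤ k ∧ T k ≤ t}.ncard ↔ T n ≤ t := by
  classical
  have hex : ∃ k, t < T k := (hlim.eventually_gt_atTop t).exists
  set k := Nat.find hex with hk
  have hiff : ∀ j, T j ≤ t ↔ j < k := fun j => by
    constructor
    · intro h
      by_contra hc
      exact absurd ((Nat.find_spec hex).trans_le (hT.monotone (not_lt.1 hc))) (not_lt.2 h)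
    · intro h
      exact not_lt.1 (Nat.find_min hex h)
  have hk0 : 0 < k := (hiff 0).1 (by rwa [h0])
  have hset : {k : ℕ | 1 ≤ k ∧ T k ≤ t} = ↑(Finset.Ico 1 k) := by
    ext j
    simp [hiff]
  rw [hset, ncard_coe_finset, Nat.card_Ico, hiff]
  omega

variable {Ω : Type*} [MeasurableSpace Ω] {μ : Measure Ω} {τ : ℕ → Ω → ℝ}

lemma measurable_count (hτ : ∀ n, Measurable (τ n)) (t : ℝ) : Measurable (count τ t) := by
  have hset : ∀ A : Set ℕ, MeasurableSet {ω | {n : ℕ | 1 ≤ n ∧ epoch τ n ω ≤ t} = A} := fun A => by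
    have : {ω | {n : ℕ | 1 ≤ n ∧ epoch τ n ω ≤ t} = A} =
        ⋂ n : ℕ, {ω | (1 ≤ n ∧ epoch τ n ω ≤ t) ↔ n ∈ A} := by
      ext ω
      simp only [mem_ofPred_eq, mem_iInter, Set.ext_iff]
    rw [this]
    refine MeasurableSet.iInter fun n => ?_
    have hle : MeasurableSet {ω | epoch τ n ω ≤ t} :=
      measurableSet_le (measurable_epoch hτ n) measurable_const
    have hlt : MeasurableSet {ω | t < epoch τ n ω} :=
      measurableSet_lt measurable_const (measurable_epoch hτ n)
    by_cases hA : n ∈ A <;> by_cases hn : 1 ≤ n <;> simp [hA, hn, hle, hlt]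
  have hne : ∀ k : ℕ, k ≠ 0 → MeasurableSet (count τ t ⁻¹' {k}) := fun k hk => by
    have : count τ t ⁻¹' {k} = ⋃ A ∈ {A : Finset ℕ | A.card = k},
        {ω | {n : ℕ | 1 ≤ n ∧ epoch τ n ω ≤ t} = (A : Set ℕ)} := by
      ext ω
      simp only [mem_preimage, mem_singleton_iff, mem_iUnion, mem_ofPred_eq, exists_prop, count]
      constructor
      · intro h
        have hfin := finite_of_ncard_ne_zero (h.trans_ne hk)
        exact ⟨hfin.toFinset, by rw [← h, ncard_eq_toFinset_card _ hfin], by simp⟩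
      · rintro ⟨A, hA, h⟩
        rw [h, ncard_coe_finset, hA]
    rw [this]
    exact MeasurableSet.biUnion (to_countable _) fun A _ => hset _
  refine measurable_to_countable' fun k => ?_
  rcases eq_or_ne k 0 with rfl | hk
  -- The value 0 also arises from infinite sets, so it is treated as the complement of the other
  -- values.
  · have : count τ t ⁻¹' {0} = (⋃ k ∈ {k : ℕ | k ≠ 0}, count τ t ⁻¹' {k})ᶜ := by
      ext ω
      simp only [mem_preimage, mem_singleton_iff, mem_compl_iff, mem_iUnion, mem_ofPred_eq,
        exists_prop, not_exists, not_and]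
      exact ⟨fun h i hi h' => hi (h'.symm.trans h), fun h => by_contra fun h' => h _ h' rfl⟩
    rw [this]
    exact (MeasurableSet.biUnion (to_countable _) fun k hk => hne k hk).compl
  · exact hne k hk

lemma indepFun_epoch (hτ : ∀ n, Measurable (τ n)) (hind : iIndepFun τ μ) (n : ℕ) :
    IndepFun (epoch τ n) (τ n) μ := by
  have := (indepFun_stopped_epoch hτ hind n).comp (measurable_pi_apply n) measurable_id
  simpa [Function.comp_def] using this

lemma meanCount_nonneg (t : ℝ) : 0 ≤ meanCount μ τ t :=
  integral_nonneg fun _ => Nat.cast_nonneg _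

end Count

/-! ### Renewal theory -/

section Renewal

variable {Ω : Type*} [MeasurableSpace Ω] {μ : Measure Ω} [IsProbabilityMeasure μ]
  {τ : ℕ → Ω → ℝ}

lemma integral_pos_of_ae_pos {f : Ω → ℝ} (hf : ∀ᵐ ω ∂μ, 0 < f ω) (hi : Integrable f μ) :
    0 < ∫ ω, f ω ∂μ := by
  rw [integral_pos_iff_support_of_nonneg_ae (hf.mono fun ω h => h.le) hi]
  have : μ (Function.support f) = 1 := by
    rw [← measure_univ (μ := μ)]
    refine measure_congr ?_
    filter_upwards [hf] with ω hω
    exact propext ⟨fun _ => trivial, fun _ => hω.ne'⟩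
  simp [this]

lemma ae_le_count_iff (hind : iIndepFun τ μ) (hid : ∀ n, IdentDistrib (τ n) (τ 0) μ μ)
    (hpos : ∀ n, ∀ᵐ ω ∂μ, 0 < τ n ω) (hint : Integrable (τ 0) μ) :
    ∀ᵐ ω ∂μ, StrictMono (fun n => epoch τ n ω) ∧
      ∀ t, 0 ≤ t → ∀ n, n ≤ count τ t ω ↔ epoch τ n ω ≤ t := by
  have hm := integral_pos_of_ae_pos (hpos 0) hint
  filter_upwards [ae_tendsto_epoch_div hind hid hint, ae_all_iff.2 hpos] with ω hω hω0
  have hmono : StrictMono fun n => epoch τ n ω := strictMono_nat_of_lt_succ fun n => by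
    rw [epoch_succ]; linarith [hω0 n]
  have hlim : Tendsto (fun n => epoch τ n ω) atTop atTop := by
    have h1 := hω.pos_mul_atTop hm (tendsto_natCast_atTop_atTop (R := ℝ))
    refine h1.congr' ?_
    filter_upwards [eventually_gt_atTop 0] with n hn
    have : (n : ℝ) ≠ 0 := by exact_mod_cast hn.ne'
    field_simp
  exact ⟨hmono, fun t ht n => le_ncard_iff_of_strictMono (epoch_zero ω) hmono hlim ht n⟩

lemma measureReal_lt_count (hind : iIndepFun τ μ) (hid : ∀ n, IdentDistrib (τ n) (τ 0) μ μ)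
    (hpos : ∀ n, ∀ᵐ ω ∂μ, 0 < τ n ω) (hint : Integrable (τ 0) μ) {t : ℝ} (ht : 0 ≤ t) (n : ℕ) :
    μ.real {ω | n < count τ t ω} = μ.real {ω | epoch τ (n + 1) ω ≤ t} := by
  refine measureReal_congr ?_
  filter_upwards [ae_le_count_iff hind hid hpos hint] with ω hω
  exact propext (hω.2 t ht (n + 1))

/-- A truncated Wald inequality: summing `min (τ i) c` while the epoch is at most `t` overshoots `t`
by at most `c`, and `T_i` is independent of `τ i`. It gives both finiteness of `E N_t` and the upper
half of the renewal theorem. -/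
lemma sum_measureReal_epoch_mul_le (hτ : ∀ n, Measurable (τ n)) (hind : iIndepFun τ μ)
    (hid : ∀ n, IdentDistrib (τ n) (τ 0) μ μ) (hpos : ∀ n, ∀ᵐ ω ∂μ, 0 < τ n ω)
    {c t : ℝ} (hc : 0 < c) (ht : 0 ≤ t) (n : ℕ) :
    (∑ i ∈ Finset.range n, μ.real {ω | epoch τ i ω ≤ t}) * ∫ ω, min (τ 0 ω) c ∂μ ≤ t + c := by
  have hmin : ∀ i, Integrable (fun ω => min (τ i ω) c) μ := fun i => by
    refine Integrable.of_bound ((hτ i).min measurable_const).aestronglyMeasurable c ?_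
    filter_upwards [hpos i] with ω hω
    rw [Real.norm_of_nonneg (le_min hω.le hc.le)]
    exact min_le_right _ _
  have hterm : ∀ i, ∫ ω, {ω | epoch τ i ω ≤ t}.indicator 1 ω * min (τ i ω) c ∂μ =
      μ.real {ω | epoch τ i ω ≤ t} * ∫ ω, min (τ 0 ω) c ∂μ := fun i => by
    have h1 := (indepFun_epoch hτ hind i).integral_fun_comp_mul_comp
      (f := (Iic t).indicator (1 : ℝ → ℝ)) (g := fun z => min z c)
      (measurable_epoch hτ i).aemeasurable (hτ i).aemeasurable
      (measurable_one.indicator measurableSet_Iic).aestronglyMeasurable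
      (measurable_id.min measurable_const).aestronglyMeasurable
    have h2 : ∫ ω, min (τ i ω) c ∂μ = ∫ ω, min (τ 0 ω) c ∂μ :=
      ((hid i).comp (measurable_id.min measurable_const)).integral_eq
    rw [← h2, ← integral_indicator_one (measurableSet_le (measurable_epoch hτ i) measurable_const)]
    exact h1
  have hi : ∀ i, Integrable (fun ω => {ω | epoch τ i ω ≤ t}.indicator 1 ω * min (τ i ω) c) μ :=
    fun i => by
    refine (hmin i).bdd_mul (c := 1) (measurable_one.indicator
      (measurableSet_le (measurable_epoch hτ i) measurable_const)).aestronglyMeasurable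
      (Eventually.of_forall fun ω => ?_)
    refine (norm_indicator_le_norm_self _ _).trans (by simp)
  rw [Finset.sum_mul]
  simp only [← hterm]
  rw [← integral_finsetSum _ fun i _ => hi i]
  have hle : ∀ᵐ ω ∂μ, (∑ i ∈ Finset.range n,
      {ω | epoch τ i ω ≤ t}.indicator (1 : Ω → ℝ) ω * min (τ i ω) c) ≤ t + c := by
    filter_upwards [ae_all_iff.2 hpos] with ω hω
    have : (∑ i ∈ Finset.range n,
        {ω | epoch τ i ω ≤ t}.indicator (1 : Ω → ℝ) ω * min (τ i ω) c) ≤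
        min (epoch τ n ω) (t + c) := by
      induction n with
      | zero => simp [epoch_zero]; linarith
      | succ n ih =>
        rw [Finset.sum_range_succ, epoch_succ]
        have h1 := ih.trans (min_le_left _ _)
        have h2 := ih.trans (min_le_right _ _)
        have h3 := hω n
        by_cases h : epoch τ n ω ≤ t
        · rw [indicator_of_mem (show ω ∈ {ω | epoch τ n ω ≤ t} from h), Pi.one_apply, one_mul]
          exact le_min (add_le_add h1 (min_le_left _ _)) (add_le_add (h1.trans h) (min_le_right _ _))
        · rw [indicator_of_notMem (show ω ∉ {ω | epoch τ n ω ≤ t} from h), zero_mul, add_zero]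
          exact le_min (by linarith) h2
    exact this.trans (min_le_right _ _)
  have := integral_mono_ae (integrable_finsetSum _ fun i _ => hi i) (integrable_const (t + c)) hle
  simpa using this

lemma integral_min_pos (hτ : ∀ n, Measurable (τ n)) (hpos : ∀ n, ∀ᵐ ω ∂μ, 0 < τ n ω)
    {c : ℝ} (hc : 0 < c) : 0 < ∫ ω, min (τ 0 ω) c ∂μ := by
  refine integral_pos_of_ae_pos ((hpos 0).mono fun ω h => lt_min h hc) ?_
  refine Integrable.of_bound ((hτ 0).min measurable_const).aestronglyMeasurable c ?_
  filter_upwards [hpos 0] with ω hω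
  rw [Real.norm_of_nonneg (le_min hω.le hc.le)]
  exact min_le_right _ _

lemma summable_measureReal_epoch (hτ : ∀ n, Measurable (τ n)) (hind : iIndepFun τ μ)
    (hid : ∀ n, IdentDistrib (τ n) (τ 0) μ μ) (hpos : ∀ n, ∀ᵐ ω ∂μ, 0 < τ n ω)
    {t : ℝ} (ht : 0 ≤ t) : Summable fun n => μ.real {ω | epoch τ n ω ≤ t} := by
  refine summable_of_sum_range_le (c := (t + 1) / ∫ ω, min (τ 0 ω) 1 ∂μ)
    (fun _ => measureReal_nonneg) fun n => ?_
  rw [le_div_iff₀ (integral_min_pos hτ hpos one_pos)]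
  exact sum_measureReal_epoch_mul_le hτ hind hid hpos one_pos ht n

lemma integrable_count_and_meanCount_eq (hτ : ∀ n, Measurable (τ n)) (hind : iIndepFun τ μ)
    (hid : ∀ n, IdentDistrib (τ n) (τ 0) μ μ) (hpos : ∀ n, ∀ᵐ ω ∂μ, 0 < τ n ω)
    (hint : Integrable (τ 0) μ) {t : ℝ} (ht : 0 ≤ t) :
    Integrable (fun ω => (count τ t ω : ℝ)) μ ∧
      meanCount μ τ t = ∑' n, μ.real {ω | epoch τ (n + 1) ω ≤ t} := by
  have hs := summable_measureReal_epoch hτ hind hid hpos ht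
  have := integrable_and_integral_natCast (μ := μ) (measurable_count hτ t)
  simp only [measureReal_lt_count hind hid hpos hint ht] at this
  exact this ((summable_nat_add_iff (f := fun n => μ.real {ω | epoch τ n ω ≤ t}) 1).2 hs)

lemma meanCount_mul_le (hτ : ∀ n, Measurable (τ n)) (hind : iIndepFun τ μ)
    (hid : ∀ n, IdentDistrib (τ n) (τ 0) μ μ) (hpos : ∀ n, ∀ᵐ ω ∂μ, 0 < τ n ω)
    (hint : Integrable (τ 0) μ) {c t : ℝ} (hc : 0 < c) (ht : 0 ≤ t) :
    meanCount μ τ t * ∫ ω, min (τ 0 ω) c ∂μ ≤ t + c := by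
  have hp := integral_min_pos hτ hpos hc
  rw [← le_div_iff₀ hp, (integrable_count_and_meanCount_eq hτ hind hid hpos hint ht).2]
  have hs := summable_measureReal_epoch hτ hind hid hpos ht
  have h1 : ∑' n, μ.real {ω | epoch τ n ω ≤ t} ≤ (t + c) / ∫ ω, min (τ 0 ω) c ∂μ :=
    Real.tsum_le_of_sum_range_le (fun _ => measureReal_nonneg) fun n =>
      (le_div_iff₀ hp).2 (sum_measureReal_epoch_mul_le hτ hind hid hpos hc ht n)
  have h2 := hs.sum_add_tsum_nat_add 1
  have h3 : 0 ≤ ∑ i ∈ Finset.range 1, μ.real {ω | epoch τ i ω ≤ t} :=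
    Finset.sum_nonneg fun _ _ => measureReal_nonneg
  linarith

/-- By the strong law `T_n ≤ n * m'` for large `n`, with `m'` slightly above the mean; taking `n`
near `θ * t` gives `T_n ≤ t` because `θ * m' < 1`. -/
lemma tendsto_measureReal_mul_le_count (hτ : ∀ n, Measurable (τ n)) (hind : iIndepFun τ μ)
    (hid : ∀ n, IdentDistrib (τ n) (τ 0) μ μ) (hpos : ∀ n, ∀ᵐ ω ∂μ, 0 < τ n ω)
    (hint : Integrable (τ 0) μ) {θ : ℝ} (hθ : 0 ≤ θ) (hθm : θ * ∫ ω, τ 0 ω ∂μ < 1) :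
    Tendsto (fun t => μ.real {ω | θ * t ≤ count τ t ω}) atTop (𝓝 1) := by
  have hset : ∀ t : ℝ, MeasurableSet {ω | θ * t ≤ count τ t ω} := fun t =>
    measurableSet_le measurable_const (measurable_from_nat.comp (measurable_count hτ t))
  set m := ∫ ω, τ 0 ω ∂μ with hm
  have hm0 : 0 < m := integral_pos_of_ae_pos (hpos 0) hint
  obtain ⟨m', hmm', hm'⟩ : ∃ m', m < m' ∧ θ * m' < 1 := by
    have : Tendsto (fun z => θ * z) (𝓝[>] m) (𝓝 (θ * m)) :=
      ((continuous_const.mul continuous_id).tendsto m).mono_left nhdsWithin_le_nhds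
    obtain ⟨z, hz1, hz2⟩ := ((this.eventually (gt_mem_nhds hθm)).and self_mem_nhdsWithin).exists
    exact ⟨z, hz2, hz1⟩
  have hm'0 : 0 < m' := hm0.trans hmm'
  have hae : ∀ᵐ ω ∂μ, Tendsto (fun t => {ω | θ * t ≤ count τ t ω}.indicator (1 : Ω → ℝ) ω)
      atTop (𝓝 1) := by
    filter_upwards [ae_le_count_iff hind hid hpos hint, ae_tendsto_epoch_div hind hid hint]
      with ω hω hlim
    obtain ⟨n₀, hn₀⟩ := eventually_atTop.1 ((hlim.eventually (gt_mem_nhds hmm')).and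
      (eventually_gt_atTop 0))
    have hn₁ := hn₀ n₀ le_rfl
    refine tendsto_const_nhds.congr' ?_
    filter_upwards [eventually_ge_atTop ((n₀ + 1) * m' / (1 - θ * m')), eventually_ge_atTop 0,
      eventually_ge_atTop ((n₀ + 1) * m')]
      with t ht ht0 ht1
    rw [indicator_of_mem]
    · rfl
    · have hle : ∀ n : ℕ, n₀ ≤ n → epoch τ n ω ≤ n * m' := fun n hn => by
        have h := hn₀ n hn
        rw [div_lt_iff₀ (by exact_mod_cast h.2)] at h
        linarith [h.1]
      set n := max n₀ ⌈θ * t⌉₊ with hn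
      have h2 : n ≤ count τ t ω := by
        refine (hω.2 t ht0 n).2 ((hle n (le_max_left _ _)).trans ?_)
        rcases le_total n₀ ⌈θ * t⌉₊ with h | h
        · rw [hn, max_eq_right h]
          have h3 := (Nat.ceil_lt_add_one (show 0 ≤ θ * t by positivity)).le
          have h4 := mul_le_mul_of_nonneg_right h3 hm'0.le
          rw [div_le_iff₀ (by linarith)] at ht
          have : 0 ≤ (n₀ : ℝ) * m' := by positivity
          nlinarith
        · rw [hn, max_eq_left h]
          nlinarith
      have h5 : θ * t ≤ n := (Nat.le_ceil _).trans (by exact_mod_cast le_max_right _ _)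
      exact h5.trans (by exact_mod_cast h2)
  have hint' : Tendsto (fun t => ∫ ω, {ω | θ * t ≤ count τ t ω}.indicator (1 : Ω → ℝ) ω ∂μ) atTop
      (𝓝 (∫ _, (1 : ℝ) ∂μ)) := by
    refine tendsto_integral_filter_of_dominated_convergence (fun _ => 1)
      (Eventually.of_forall fun t => (measurable_one.indicator (hset t)).aestronglyMeasurable)
      (Eventually.of_forall fun t => Eventually.of_forall fun ω => ?_) (integrable_const _) hae
    exact (norm_indicator_le_norm_self _ _).trans (by simp)
  simpa [integral_indicator_one, hset] using hint'

lemma mul_measureReal_le_meanCount (hτ : ∀ n, Measurable (τ n)) (hind : iIndepFun τ μ)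
    (hid : ∀ n, IdentDistrib (τ n) (τ 0) μ μ) (hpos : ∀ n, ∀ᵐ ω ∂μ, 0 < τ n ω)
    (hint : Integrable (τ 0) μ) {t : ℝ} (ht : 0 ≤ t) (r : ℝ) :
    r * μ.real {ω | r ≤ count τ t ω} ≤ meanCount μ τ t :=
  mul_meas_ge_le_integral_of_nonneg (Eventually.of_forall fun _ => Nat.cast_nonneg _)
    (integrable_count_and_meanCount_eq hτ hind hid hpos hint ht).1 r

/-- The elementary renewal theorem: Markov's inequality and the law of large numbers below, the
truncated Wald inequality with large `c` above. -/
theorem tendsto_meanCount_div (hτ : ∀ n, Measurable (τ n)) (hind : iIndepFun τ μ)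
    (hid : ∀ n, IdentDistrib (τ n) (τ 0) μ μ) (hpos : ∀ n, ∀ᵐ ω ∂μ, 0 < τ n ω)
    (hint : Integrable (τ 0) μ) :
    Tendsto (fun t => meanCount μ τ t / t) atTop (𝓝 (1 / ∫ ω, τ 0 ω ∂μ)) := by
  set m := ∫ ω, τ 0 ω ∂μ with hm
  have hm0 : 0 < m := integral_pos_of_ae_pos (hpos 0) hint
  refine tendsto_order.2 ⟨fun r hr => ?_, fun r hr => ?_⟩
  · obtain ⟨θ, hθ1, hθ2⟩ := exists_between (max_lt hr (show 0 < 1 / m by positivity))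
    have hθ0 : 0 < θ := (le_max_right _ _).trans_lt hθ1
    have hθm : θ * m < 1 := by rwa [lt_div_iff₀ hm0] at hθ2
    have hlim := (tendsto_measureReal_mul_le_count hτ hind hid hpos hint hθ0.le hθm).const_mul θ
    rw [mul_one] at hlim
    filter_upwards [hlim.eventually (lt_mem_nhds ((le_max_left _ _).trans_lt hθ1)),
      eventually_gt_atTop 0] with t ht ht0
    rw [lt_div_iff₀ ht0]
    have := mul_measureReal_le_meanCount hτ hind hid hpos hint ht0.le (θ * t)
    nlinarith
  · have hr0 : 0 < r := lt_trans (by positivity) hr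
    have hmr : 1 / r < m := by
      rw [gt_iff_lt, div_lt_iff₀ hm0] at hr
      rw [div_lt_iff₀ hr0]
      linarith
    have hlim : Tendsto (fun c : ℝ => ∫ ω, min (τ 0 ω) c ∂μ) atTop (𝓝 m) := by
      refine tendsto_integral_filter_of_dominated_convergence (τ 0)
        (Eventually.of_forall fun c => ((hτ 0).min measurable_const).aestronglyMeasurable) ?_ hint
        (Eventually.of_forall fun ω => ?_)
      · filter_upwards [eventually_gt_atTop 0] with c hc
        filter_upwards [hpos 0] with ω hω
        rw [Real.norm_of_nonneg (le_min hω.le hc.le)]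
        exact min_le_left _ _
      · refine tendsto_const_nhds.congr' ?_
        filter_upwards [eventually_ge_atTop (τ 0 ω)] with c hc
        rw [min_eq_left hc]
    obtain ⟨c, hc, hc0⟩ := ((hlim.eventually (lt_mem_nhds hmr)).and (eventually_gt_atTop 0)).exists
    set q := ∫ ω, min (τ 0 ω) c ∂μ with hq
    have hq0 : 0 < q := integral_min_pos hτ hpos hc0
    have hqr : 1 < r * q := by
      rw [div_lt_iff₀ hr0] at hc
      linarith
    filter_upwards [eventually_gt_atTop 0, eventually_gt_atTop (c / (r * q - 1))] with t ht0 ht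
    rw [div_lt_iff₀ (by linarith)] at ht
    rw [div_lt_iff₀ ht0]
    have h1 := meanCount_mul_le hτ hind hid hpos hint hc0 ht0.le
    have h2 : meanCount μ τ t * q < r * t * q := by linarith
    exact lt_of_mul_lt_mul_right h2 hq0.le

lemma eventually_le_measureReal_count_ge (hτ : ∀ n, Measurable (τ n)) (hind : iIndepFun τ μ)
    (hid : ∀ n, IdentDistrib (τ n) (τ 0) μ μ) (hpos : ∀ n, ∀ᵐ ω ∂μ, 0 < τ n ω)
    (hint : Integrable (τ 0) μ) {e : ℝ} (he : 0 < e) (he1 : e < 1) :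
    ∀ᶠ t in atTop, 1 - e ≤ μ.real {ω | (1 - e) * meanCount μ τ t ≤ count τ t ω} := by
  set m := ∫ ω, τ 0 ω ∂μ with hm
  have hm0 : 0 < m := integral_pos_of_ae_pos (hpos 0) hint
  set r := (1 + e) / m with hr
  have hmr : 1 / m < r := by rw [hr]; gcongr; linarith
  have hr0 : 0 < r := by positivity
  have hθ : (1 - e) * r * m < 1 := by
    rw [hr, mul_assoc, div_mul_cancel₀ _ hm0.ne']
    nlinarith
  filter_upwards [(tendsto_measureReal_mul_le_count hτ hind hid hpos hint
      (mul_nonneg (by linarith) hr0.le) hθ).eventually (lt_mem_nhds (show 1 - e < 1 by linarith)),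
    (tendsto_meanCount_div hτ hind hid hpos hint).eventually (gt_mem_nhds hmr),
    eventually_gt_atTop 0] with t h1 h2 h3
  refine h1.le.trans (measureReal_mono fun ω hω => ?_)
  rw [div_lt_iff₀ h3] at h2
  have h4 := mul_le_mul_of_nonneg_left h2.le (show 0 ≤ 1 - e by linarith)
  have h5 : (1 - e) * r * t ≤ count τ t ω := hω
  exact (h4.trans_eq (by ring)).trans h5

/-- `T_{n+1} ≤ t` forces both `T_n ≤ t₀` and `τ n ≤ t`. The second factor is what keeps later
estimates uniform as `t → 0`, where `E N_t` may vanish. -/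
lemma measureReal_epoch_succ_le (hτ : ∀ n, Measurable (τ n)) (hind : iIndepFun τ μ)
    (hid : ∀ n, IdentDistrib (τ n) (τ 0) μ μ) (hpos : ∀ n, ∀ᵐ ω ∂μ, 0 < τ n ω)
    {t t₀ : ℝ} (ht : t ≤ t₀) (n : ℕ) :
    μ.real {ω | epoch τ (n + 1) ω ≤ t} ≤
      μ.real {ω | epoch τ n ω ≤ t₀} * μ.real {ω | epoch τ 1 ω ≤ t} := by
  have h1 := (indepFun_epoch hτ hind n).measure_inter_preimage_eq_mul (Iic t₀) (Iic t)
    measurableSet_Iic measurableSet_Iic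
  have h2 : μ.real (τ n ⁻¹' Iic t) = μ.real {ω | epoch τ 1 ω ≤ t} := by
    have h3 : {ω | epoch τ 1 ω ≤ t} = τ 0 ⁻¹' Iic t := by
      ext ω; simp [epoch]
    rw [h3]
    simp only [Measure.real, (hid n).measure_mem_eq measurableSet_Iic]
  have h4 : μ.real (epoch τ n ⁻¹' Iic t₀ ∩ τ n ⁻¹' Iic t) =
      μ.real {ω | epoch τ n ω ≤ t₀} * μ.real {ω | epoch τ 1 ω ≤ t} := by
    rw [← h2]
    simp only [Measure.real, h1, ENNReal.toReal_mul]
    rfl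
  rw [← h4]
  refine ENNReal.toReal_mono (measure_ne_top _ _) (measure_mono_ae ?_)
  filter_upwards [ae_all_iff.2 hpos] with ω hω h
  have h5 : epoch τ (n + 1) ω ≤ t := h
  rw [epoch_succ] at h5
  have h6 : 0 ≤ epoch τ n ω := Finset.sum_nonneg fun i _ => (hω i).le
  exact ⟨show epoch τ n ω ≤ t₀ by linarith [hω n], show τ n ω ≤ t by linarith⟩

/-- `J` is chosen from the convergent series at `t₀` alone. The discarded part of the series is at
most `e * P(T_1 ≤ t)`, hence at most `e * E N_t`, however small `t` is. -/
lemma exists_le_integral_min_count (hτ : ∀ n, Measurable (τ n)) (hind : iIndepFun τ μ)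
    (hid : ∀ n, IdentDistrib (τ n) (τ 0) μ μ) (hpos : ∀ n, ∀ᵐ ω ∂μ, 0 < τ n ω)
    (hint : Integrable (τ 0) μ) {t₀ e : ℝ} (ht₀ : 0 ≤ t₀) (he : 0 < e) :
    ∃ J : ℕ, ∀ t, 0 ≤ t → t ≤ t₀ →
      (1 - e) * meanCount μ τ t ≤ ∫ ω, ((min (count τ t ω) J : ℕ) : ℝ) ∂μ := by
  obtain ⟨J, hJ⟩ := ((tendsto_sum_nat_add fun n => μ.real {ω | epoch τ n ω ≤ t₀}).eventually
    (gt_mem_nhds he)).exists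
  refine ⟨J, fun t ht htt => ?_⟩
  rw [integral_min_natCast (measurable_count hτ t)]
  simp only [measureReal_lt_count hind hid hpos hint ht]
  rw [(integrable_count_and_meanCount_eq hτ hind hid hpos hint ht).2]
  set g : ℕ → ℝ := fun n => μ.real {ω | epoch τ (n + 1) ω ≤ t} with hg
  have hg0 : ∀ n, 0 ≤ g n := fun n => measureReal_nonneg
  have hs : Summable g :=
    (summable_nat_add_iff (f := fun n => μ.real {ω | epoch τ n ω ≤ t}) 1).2
      (summable_measureReal_epoch hτ hind hid hpos ht)
  have hs₀ := (summable_nat_add_iff (f := fun n => μ.real {ω | epoch τ n ω ≤ t₀}) J).2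
    (summable_measureReal_epoch hτ hind hid hpos ht₀)
  have h1 := hs.sum_add_tsum_nat_add J
  have h2 : g 0 ≤ ∑' n, g n := hs.le_tsum 0 fun j _ => hg0 j
  have h3 : ∑' n, g (n + J) ≤ (∑' n, μ.real {ω | epoch τ (n + J) ω ≤ t₀}) * g 0 := by
    rw [← tsum_mul_right]
    exact ((summable_nat_add_iff J).2 hs).tsum_le_tsum
      (fun n => measureReal_epoch_succ_le hτ hind hid hpos htt (n + J)) (hs₀.mul_right _)
  have h4 := mul_le_mul_of_nonneg_right hJ.le (hg0 0)
  have h5 := mul_le_mul_of_nonneg_left h2 he.le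
  linarith

end Renewal

/-! ### Concavity of the window integral in its length -/

section Window

variable {D : ℝ → ℝ}

/-- The window integral is concave in `z`, and `D (x + z₀)` is a supergradient at `z₀`. -/
lemma integral_window_le_tangent (hD : Antitone D) (x z z₀ : ℝ) :
    ∫ v in x..(x + z), D v ≤ (∫ v in x..(x + z₀), D v) + D (x + z₀) * (z - z₀) := by
  have h := integral_adjacent hD x (x + z₀) (x + z)
  rcases le_total z₀ z with hz | hz
  · have h1 := integral_le_of_antitone hD (show x + z₀ ≤ x + z by linarith)
    linarith
  · have h1 := le_integral_of_antitone hD (show x + z ≤ x + z₀ by linarith)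
    have h2 := intervalIntegral.integral_symm (f := D) (μ := volume) (x + z) (x + z₀)
    linarith

lemma integral_window_mono (hD : Antitone D) (h0 : ∀ v, 0 ≤ D v) (x : ℝ) {z w : ℝ} (h : z ≤ w) :
    ∫ v in x..(x + z), D v ≤ ∫ v in x..(x + w), D v := by
  have h1 := integral_adjacent hD x (x + z) (x + w)
  have h2 := integral_nonneg_of_nonneg h0 (show x + z ≤ x + w by linarith)
  linarith

lemma mul_integral_window_le (hD : Antitone D) (x : ℝ) {z θ : ℝ} (hz : 0 ≤ z) (hθ : 0 ≤ θ)
    (hθ1 : θ ≤ 1) : θ * ∫ v in x..(x + z), D v ≤ ∫ v in x..(x + θ * z), D v := by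
  have h1 := integral_window_le_tangent hD x z (θ * z)
  have h2 := le_integral_of_antitone hD (show x ≤ x + θ * z by nlinarith)
  have h3 := mul_le_mul_of_nonneg_left h1 hθ
  have h4 := mul_le_mul_of_nonneg_left h2 (show 0 ≤ 1 - θ by linarith)
  linarith

end Window

/-! ### The running maximum and averaging over the random horizon -/

section RunningMax

variable {Ω : Type*} [MeasurableSpace Ω] {μ : Measure Ω} [IsProbabilityMeasure μ]
  {τ Y : ℕ → Ω → ℝ}

/-- Strictly increasing epochs mean that no partial sum is skipped: `S_k` is attained at time `T_k`
for each `k ≤ N_t`. -/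
lemma ae_lt_runningMax_iff (hind : iIndepFun τ μ) (hid : ∀ n, IdentDistrib (τ n) (τ 0) μ μ)
    (hpos : ∀ n, ∀ᵐ ω ∂μ, 0 < τ n ω) (hint : Integrable (τ 0) μ) {t : ℝ} (ht : 0 ≤ t) (x : ℝ) :
    ∀ᵐ ω ∂μ, x < runningMax τ Y t ω ↔ ∃ k ≤ count τ t ω, x < epoch Y k ω := by
  filter_upwards [ae_le_count_iff hind hid hpos hint] with ω hω
  obtain ⟨hmono, hcount⟩ := hω
  have himage : (fun u : ℝ => process τ Y u ω) '' Icc 0 t =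
      (fun k => epoch Y k ω) '' Iic (count τ t ω) := by
    ext z
    simp only [mem_image, mem_Icc, mem_Iic]
    constructor
    · rintro ⟨u, ⟨hu0, hut⟩, rfl⟩
      exact ⟨count τ u ω, (hcount t ht _).2 (((hcount u hu0 _).1 le_rfl).trans hut), rfl⟩
    · rintro ⟨k, hk, rfl⟩
      have h0 : 0 ≤ epoch τ k ω := by
        have := hmono.monotone (Nat.zero_le k)
        simpa [epoch_zero] using this
      refine ⟨epoch τ k ω, ⟨h0, (hcount t ht k).1 hk⟩, ?_⟩
      have : count τ (epoch τ k ω) ω = k :=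
        le_antisymm (hmono.le_iff_le.1 ((hcount _ h0 _).1 le_rfl)) ((hcount _ h0 k).2 le_rfl)
      rw [process, this]
      rfl
  rw [runningMax, himage, lt_csSup_iff ((finite_Iic _).image _).bddAbove
    ((nonempty_Iic).image _), exists_mem_image]
  rfl

lemma measureReal_lt_runningMax (hτ : ∀ n, Measurable (τ n)) (hY : ∀ n, Measurable (Y n))
    (hind : iIndepFun τ μ) (hid : ∀ n, IdentDistrib (τ n) (τ 0) μ μ)
    (hτY : IndepFun (fun ω n => τ n ω) (fun ω n => Y n ω) μ)
    (hpos : ∀ n, ∀ᵐ ω ∂μ, 0 < τ n ω) (hint : Integrable (τ 0) μ) {t : ℝ} (ht : 0 ≤ t) (x : ℝ) :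
    μ.real {ω | x < runningMax τ Y t ω} =
      ∫ ω, μ.real {ω' | ∃ k ≤ count τ t ω, x < epoch Y k ω'} ∂μ := by
  have h1 : μ {ω | x < runningMax τ Y t ω} = μ {ω | ∃ k ≤ count τ t ω, x < epoch Y k ω} :=
    measure_congr ((ae_lt_runningMax_iff hind hid hpos hint ht x).mono fun ω h => propext h)
  set coord : ℕ → (ℕ → ℝ) → ℝ := fun n s => s n with hcoord
  have hcm : ∀ n, Measurable (coord n) := fun n => measurable_pi_apply n
  set E : Set (ℕ × (ℕ → ℝ)) := {p | ∃ k ≤ p.1, x < epoch coord k p.2} with hE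
  have hEm : MeasurableSet E := by
    have : E = ⋃ k : ℕ, {p | k ≤ p.1} ∩ {p | x < epoch coord k p.2} := by
      ext p; simp [hE]
    rw [this]
    exact MeasurableSet.iUnion fun k => (measurableSet_le measurable_const measurable_fst).inter
      (measurableSet_lt measurable_const ((measurable_epoch hcm k).comp measurable_snd))
  have hNm := measurable_count hτ t
  have hYm : Measurable fun ω n => Y n ω := measurable_pi_lambda _ hY
  have hNY : IndepFun (count τ t) (fun ω n => Y n ω) μ :=
    hτY.comp (φ := count coord t) (ψ := id) (measurable_count hcm t) measurable_id
  have h2 : μ {ω | ∃ k ≤ count τ t ω, x < epoch Y k ω} =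
      ∫⁻ ω, μ {ω' | ∃ k ≤ count τ t ω, x < epoch Y k ω'} ∂μ := by
    have h3 : {ω | ∃ k ≤ count τ t ω, x < epoch Y k ω} =
        (fun ω => (count τ t ω, fun n => Y n ω)) ⁻¹' E := rfl
    rw [h3, ← Measure.map_apply (hNm.prodMk hYm) hEm,
      hNY.map_prod_eq_prod_map_map hNm.aemeasurable hYm.aemeasurable, Measure.prod_apply hEm,
      lintegral_map measurable_from_nat hNm]
    refine lintegral_congr fun ω => ?_
    rw [Measure.map_apply hYm (measurable_prodMk_left hEm)]
    rfl
  rw [Measure.real, h1, h2]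
  refine (integral_toReal ?_ (Eventually.of_forall fun ω => measure_lt_top _ _)).symm
  exact ((measurable_from_nat (f := fun n => μ {ω' | ∃ k ≤ n, x < epoch Y k ω'})).comp
    hNm).aemeasurable

lemma integrable_window_count {F : Measure ℝ} [IsProbabilityMeasure F]
    (hτ : ∀ n, Measurable (τ n)) (hind : iIndepFun τ μ)
    (hid : ∀ n, IdentDistrib (τ n) (τ 0) μ μ) (hpos : ∀ n, ∀ᵐ ω ∂μ, 0 < τ n ω)
    (hint : Integrable (τ 0) μ) {t a : ℝ} (ht : 0 ≤ t) (ha : 0 ≤ a) (x : ℝ) :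
    Integrable (fun ω => ∫ v in x..(x + count τ t ω * a), tail F v) μ := by
  refine Integrable.mono'
    ((integrable_count_and_meanCount_eq hτ hind hid hpos hint ht).1.mul_const a)
    ((measurable_from_nat (f := fun n : ℕ => ∫ v in x..(x + n * a), tail F v)).comp
      (measurable_count hτ t)).aestronglyMeasurable (Eventually.of_forall fun ω => ?_)
  have hna : 0 ≤ (count τ t ω : ℝ) * a := by positivity
  rw [Real.norm_of_nonneg (integral_nonneg_of_nonneg (fun v => tail_nonneg v) (by linarith))]
  refine (integral_le_of_antitone tail_antitone (by linarith)).trans ?_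
  have := tail_le_one (F := F) x
  nlinarith

/-- Jensen's inequality: average the tangent bound at the mean, where the linear term vanishes. -/
lemma integral_window_count_le {F : Measure ℝ} [IsProbabilityMeasure F]
    (hτ : ∀ n, Measurable (τ n)) (hind : iIndepFun τ μ)
    (hid : ∀ n, IdentDistrib (τ n) (τ 0) μ μ) (hpos : ∀ n, ∀ᵐ ω ∂μ, 0 < τ n ω)
    (hint : Integrable (τ 0) μ) {t a : ℝ} (ht : 0 ≤ t) (ha : 0 ≤ a) (x : ℝ) :
    ∫ ω, (∫ v in x..(x + count τ t ω * a), tail F v) ∂μ ≤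
      ∫ v in x..(x + a * meanCount μ τ t), tail F v := by
  have hN := (integrable_count_and_meanCount_eq hτ hind hid hpos hint ht).1
  set z₀ := a * meanCount μ τ t with hz₀
  set G := ∫ v in x..(x + z₀), tail F v
  have hi : Integrable (fun ω => (count τ t ω : ℝ) * a - z₀) μ :=
    (hN.mul_const a).sub (integrable_const _)
  refine (integral_mono (integrable_window_count hτ hind hid hpos hint ht ha x)
    ((integrable_const G).add (hi.const_mul (tail F (x + z₀)))) fun ω =>
      integral_window_le_tangent tail_antitone x _ z₀).trans_eq ?_
  rw [integral_add' (integrable_const G) (hi.const_mul (tail F (x + z₀))), integral_const_mul,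
    integral_sub (hN.mul_const a) (integrable_const _), integral_mul_const]
  simp [hz₀, meanCount, mul_comm]

lemma eventually_le_integral_window_count {F : Measure ℝ} (hF : IsStrongSubexponential F)
    (hτ : ∀ n, Measurable (τ n)) (hind : iIndepFun τ μ)
    (hid : ∀ n, IdentDistrib (τ n) (τ 0) μ μ) (hpos : ∀ n, ∀ᵐ ω ∂μ, 0 < τ n ω)
    (hint : Integrable (τ 0) μ) {a e : ℝ} (ha : 0 < a) (he : 0 < e) (he1 : e < 1) :
    ∀ᶠ x in atTop, ∀ t : ℝ, 0 < t →
      (1 - e) * ∫ v in x..(x + a * meanCount μ τ t), tail F v ≤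
        ∫ ω, (∫ v in x..(x + count τ t ω * a), tail F v) ∂μ := by
  have := hF.isProbabilityMeasure
  have hanti : Antitone (tail F) := tail_antitone
  have hnn : ∀ v, 0 ≤ tail F v := fun v => tail_nonneg v
  set δ := e / 2 with hδ
  have hδ0 : 0 < δ := by positivity
  have hsq : 1 - e ≤ (1 - δ) * (1 - δ) := by nlinarith [sq_nonneg δ]
  obtain ⟨t₀, ht₀⟩ := eventually_atTop.1
    (eventually_le_measureReal_count_ge hτ hind hid hpos hint hδ0 (by linarith))
  obtain ⟨J, hJ⟩ := exists_le_integral_min_count hτ hind hid hpos hint (le_max_right t₀ 0) hδ0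
  obtain ⟨x₀, hx₀⟩ := eventually_atTop.1 (hF.eventually_tail_sub_le hδ0 (J * a))
  filter_upwards [eventually_ge_atTop x₀] with x hx t ht
  have hEN : 0 ≤ meanCount μ τ t := meanCount_nonneg t
  have hI := integrable_window_count (F := F) hτ hind hid hpos hint ht.le ha.le x
  set z₀ := a * meanCount μ τ t with hz₀
  have hz₀0 : 0 ≤ z₀ := by positivity
  set G := ∫ v in x..(x + z₀), tail F v with hG
  have hG0 : 0 ≤ G := integral_nonneg_of_nonneg hnn (by linarith)
  have hpt0 : ∀ ω, 0 ≤ ∫ v in x..(x + count τ t ω * a), tail F v := fun ω =>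
    integral_nonneg_of_nonneg hnn (by
      have : 0 ≤ (count τ t ω : ℝ) * a := by positivity
      linarith)
  refine (mul_le_mul_of_nonneg_right hsq hG0).trans ?_
  -- For large `t` the count is at least `(1 - δ) * E N_t` with probability at least `1 - δ`. For `t
  -- < t₀` the count is cut at `J`, and the tail is nearly constant on `[x, x + J * a]`.
  rcases le_or_gt t₀ t with htt | htt
  · have hA := ht₀ t htt
    set A := {ω | (1 - δ) * meanCount μ τ t ≤ count τ t ω} with hAdef
    have hAm : MeasurableSet A :=
      measurableSet_le measurable_const (measurable_from_nat.comp (measurable_count hτ t))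
    have h1 : ∫ ω, A.indicator (fun _ => (1 - δ) * G) ω ∂μ ≤
        ∫ ω, (∫ v in x..(x + count τ t ω * a), tail F v) ∂μ := by
      refine integral_mono ((integrable_const _).indicator hAm) hI fun ω => ?_
      by_cases hω : ω ∈ A
      · rw [indicator_of_mem hω]
        refine (mul_integral_window_le hanti x hz₀0 (by linarith) (by linarith)).trans ?_
        refine integral_window_mono hanti hnn x ?_
        have h2 : (1 - δ) * meanCount μ τ t ≤ count τ t ω := hω
        have h3 := mul_le_mul_of_nonneg_right h2 ha.le
        linarith
      · rw [indicator_of_notMem hω]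
        exact hpt0 ω
    rw [integral_indicator_const _ hAm, smul_eq_mul] at h1
    have h2 := mul_le_mul_of_nonneg_right hA (show 0 ≤ (1 - δ) * G from
      mul_nonneg (by linarith) hG0)
    linarith
  · have hJt := hJ t ht.le (htt.le.trans (le_max_left _ _))
    have hshift := hx₀ (x + J * a) (by
      have : 0 ≤ (J : ℝ) * a := by positivity
      linarith)
    rw [add_sub_cancel_right] at hshift
    set c := tail F (x + J * a) with hc
    have hc0 : 0 ≤ c := hnn _
    have hct : (1 - δ) * tail F x ≤ c := by nlinarith [hnn x]
    have hminI : Integrable (fun ω => ((min (count τ t ω) J : ℕ) : ℝ)) μ := by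
      refine Integrable.of_bound (measurable_from_nat.comp
        ((measurable_count hτ t).min measurable_const)).aestronglyMeasurable J
        (Eventually.of_forall fun ω => ?_)
      rw [Real.norm_of_nonneg (Nat.cast_nonneg _)]
      exact_mod_cast min_le_right _ _
    have h1 : ∫ ω, ((min (count τ t ω) J : ℕ) : ℝ) * (a * c) ∂μ ≤
        ∫ ω, (∫ v in x..(x + count τ t ω * a), tail F v) ∂μ := by
      refine integral_mono (hminI.mul_const _) hI fun ω => ?_
      simp only
      set j := min (count τ t ω) J
      have hj1 : (j : ℝ) ≤ count τ t ω := by exact_mod_cast min_le_left _ _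
      have hj2 : (j : ℝ) ≤ J := by exact_mod_cast min_le_right _ _
      have hja : 0 ≤ (j : ℝ) * a := by positivity
      have h2 := integral_window_mono hanti hnn x (mul_le_mul_of_nonneg_right hj1 ha.le)
      have h3 := le_integral_of_antitone hanti (show x ≤ x + j * a by linarith)
      have h4 : c ≤ tail F (x + j * a) := hanti (by nlinarith)
      have h5 := mul_le_mul_of_nonneg_left h4 hja
      linarith
    rw [integral_mul_const] at h1
    have h2 := mul_le_mul_of_nonneg_right hJt (show 0 ≤ a * c by positivity)
    have h3 := integral_le_of_antitone hanti (show x ≤ x + z₀ by linarith)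
    rw [add_sub_cancel_left] at h3
    have h4 := mul_le_mul_of_nonneg_left h3 (show 0 ≤ (1 - δ) * (1 - δ) by nlinarith)
    have h5 := mul_le_mul_of_nonneg_left hct
      (show 0 ≤ (1 - δ) * z₀ from mul_nonneg (by linarith) hz₀0)
    have h6 : (1 - δ) * meanCount μ τ t * (a * c) = (1 - δ) * z₀ * c := by rw [hz₀]; ring
    linarith

theorem eventually_abs_sub_le (hτ : ∀ n, Measurable (τ n)) (hY : ∀ n, Measurable (Y n))
    (hind : iIndepFun τ μ) (hid : ∀ n, IdentDistrib (τ n) (τ 0) μ μ)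
    (hYind : iIndepFun Y μ) (hYid : ∀ n, IdentDistrib (Y n) (Y 0) μ μ)
    (hτY : IndepFun (fun ω n => τ n ω) (fun ω n => Y n ω) μ)
    (hpos : ∀ n, ∀ᵐ ω ∂μ, 0 < τ n ω) (hint : Integrable (τ 0) μ) (hYint : Integrable (Y 0) μ)
    {F : Measure ℝ} (hF : IsStrongSubexponential F)
    (hFν : ∀ v, 0 ≤ v → (μ.map (Y 0)).real (Ioi v) = tail F v) {a : ℝ} (ha : 0 < a)
    (hmean : ∫ ω, Y 0 ω ∂μ = -a) {ε : ℝ} (hε : 0 < ε) :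
    ∀ᶠ x in atTop, ∀ t : ℝ, 0 < t →
      |μ.real {ω | x < runningMax τ Y t ω} -
        1 / a * ∫ v in x..(x + a * meanCount μ τ t), tail F v| ≤
      ε * (1 / a * ∫ v in x..(x + a * meanCount μ τ t), tail F v) := by
  have := hF.isProbabilityMeasure
  -- The lower bound loses `1 - δ` twice, for the walk and for the horizon; `δ ≤ ε / 2` gives `(1 -
  -- δ)^2 ≥ 1 - ε`.
  set δ := min (ε / 2) (1 / 2) with hδ
  have hδ0 : 0 < δ := by positivity
  have hδ1 : δ < 1 := (min_le_right _ _).trans_lt (by norm_num)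
  have hδε : δ ≤ ε / 2 := min_le_left _ _
  filter_upwards [eventually_measureReal_exceed_le hY hYind hYid hYint hF hFν ha hmean hε,
    eventually_le_measureReal_exceed hY hYind hYid hYint hF hFν ha hmean hδ0 hδ1,
    eventually_le_integral_window_count hF hτ hind hid hpos hint ha hδ0 hδ1] with x h1 h2 h3 t ht
  have h3 := h3 t ht
  have hEN : 0 ≤ meanCount μ τ t := meanCount_nonneg t
  rw [measureReal_lt_runningMax hτ hY hind hid hτY hpos hint ht.le x]
  have hI := integrable_window_count (F := F) hτ hind hid hpos hint ht.le ha.le x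
  have hpI : Integrable (fun ω => μ.real {ω' | ∃ k ≤ count τ t ω, x < epoch Y k ω'}) μ := by
    refine Integrable.of_bound
      ((measurable_from_nat (f := fun n => μ.real {ω' | ∃ k ≤ n, x < epoch Y k ω'})).comp
        (measurable_count hτ t)).aestronglyMeasurable 1 (Eventually.of_forall fun ω => ?_)
    rw [Real.norm_of_nonneg measureReal_nonneg]
    exact measureReal_le_one
  have hup := integral_mono hpI ((hI.const_mul (1 / a)).const_mul (1 + ε))
    fun ω => h1 (count τ t ω)
  have hlow := integral_mono ((hI.const_mul (1 / a)).const_mul (1 - δ)) hpI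
    fun ω => h2 (count τ t ω)
  rw [integral_const_mul, integral_const_mul] at hup hlow
  have hjensen := integral_window_count_le (F := F) hτ hind hid hpos hint ht.le ha.le x
  set p := ∫ ω, μ.real {ω' | ∃ k ≤ count τ t ω, x < epoch Y k ω'} ∂μ
  set I := ∫ ω, (∫ v in x..(x + count τ t ω * a), tail F v) ∂μ
  set G := ∫ v in x..(x + a * meanCount μ τ t), tail F v
  have hG0 : 0 ≤ G := integral_nonneg_of_nonneg (fun v => tail_nonneg v)
    (by have : 0 ≤ a * meanCount μ τ t := by positivity
        linarith)
  have ha' : 0 ≤ 1 / a := by positivity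
  have b1 := mul_le_mul_of_nonneg_left hjensen ha'
  have b2 := mul_le_mul_of_nonneg_left h3 ha'
  have b3 := mul_le_mul_of_nonneg_left b1 (show 0 ≤ 1 + ε by linarith)
  have b4 := mul_le_mul_of_nonneg_left b2 (show 0 ≤ 1 - δ by linarith)
  have hR0 : 0 ≤ 1 / a * G := mul_nonneg ha' hG0
  have b5 : (1 - ε) * (1 / a * G) ≤ (1 - δ) * (1 / a * ((1 - δ) * G)) := by
    rw [show (1 - δ) * (1 / a * ((1 - δ) * G)) = ((1 - δ) * (1 - δ)) * (1 / a * G) by ring]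
    exact mul_le_mul_of_nonneg_right (by nlinarith [sq_nonneg δ]) hR0
  rw [abs_le]
  constructor <;> linarith

end RunningMax

/-- By concavity and vanishing at length 0, a relative change of the length changes the integral by
no larger a relative amount. This allows `lam * t` to replace `E N_t`. -/
lemma abs_integral_window_sub_le {D : ℝ → ℝ} (hD : Antitone D) (h0 : ∀ v, 0 ≤ D v) (x : ℝ)
    {z w e : ℝ} (hw : 0 ≤ w) (he : 0 ≤ e) (he1 : e ≤ 1) (h1 : (1 - e) * w ≤ z)
    (h2 : z ≤ (1 + e) * w) :
    |(∫ v in x..(x + z), D v) - ∫ v in x..(x + w), D v| ≤ e * ∫ v in x..(x + w), D v := by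
  have b1 := (mul_integral_window_le hD x hw (show 0 ≤ 1 - e by linarith) (by linarith)).trans
    (integral_window_mono hD h0 x h1)
  have b2 := mul_integral_window_le hD x (z := (1 + e) * w) (θ := 1 / (1 + e)) (by positivity)
    (by positivity) ((div_le_one (by linarith)).2 (by linarith))
  rw [← mul_assoc, one_div_mul_cancel (by linarith), one_mul, one_div_mul_eq_div,
    div_le_iff₀ (by linarith)] at b2
  have b3 := integral_window_mono hD h0 x h2
  rw [abs_le]
  constructor <;> linarith

end CompoundRenewal

/- In the conclusion, equivalence along `atTop ×ˢ 𝓟 (Ioi 0)` in the variables `(x, t)` is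
equivalence as `x → ∞`, uniformly for all `t > 0`; equivalence along `atTop ×ˢ atTop` is
equivalence as `x, t → ∞`. -/
theorem theorem1 {Ω : Type*} [MeasurableSpace Ω] (μ : Measure Ω) [IsProbabilityMeasure μ]
    (τ Y : ℕ → Ω → ℝ)
    (hτ_meas : ∀ n, Measurable (τ n)) (hY_meas : ∀ n, Measurable (Y n))
    (hτ_indep : iIndepFun τ μ) (hτ_ident : ∀ n, IdentDistrib (τ n) (τ 0) μ μ)
    (hY_indep : iIndepFun Y μ) (hY_ident : ∀ n, IdentDistrib (Y n) (Y 0) μ μ)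
    (hτY_indep : IndepFun (fun ω n => τ n ω) (fun ω n => Y n ω) μ)
    (hτ_pos : ∀ n, ∀ᵐ ω ∂μ, 0 < τ n ω) (hτ_int : Integrable (τ 0) μ)
    (hY_int : Integrable (Y 0) μ)
    (lam b : ℝ) (hlam : lam = 1 / ∫ ω, τ 0 ω ∂μ) (hb : b = ∫ ω, Y 0 ω ∂μ) (hb_neg : b < 0)
    (B : Measure ℝ) (hB : B = μ.map (fun ω => max (Y 0 ω) 0))
    (hB_strong : CompoundRenewal.IsStrongSubexponential B) :
    (∀ t : ℝ, 0 < t → Integrable (fun ω => (CompoundRenewal.count τ t ω : ℝ)) μ) ∧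
    ((fun p : ℝ × ℝ => μ.real {ω | p.1 < CompoundRenewal.runningMax τ Y p.2 ω})
      ~[atTop ×ˢ 𝓟 (Ioi (0 : ℝ))]
      (fun p : ℝ × ℝ => 1 / |b| *
        ∫ v in p.1..(p.1 + |b| * CompoundRenewal.meanCount μ τ p.2),
          CompoundRenewal.tail B v)) ∧
    ((fun p : ℝ × ℝ => μ.real {ω | p.1 < CompoundRenewal.runningMax τ Y p.2 ω})
      ~[atTop ×ˢ atTop]
      (fun p : ℝ × ℝ => 1 / |b| *
        ∫ v in p.1..(p.1 + |b| * lam * p.2), CompoundRenewal.tail B v)) := by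
  open CompoundRenewal in
  have hBp := hB_strong.isProbabilityMeasure
  have habs : |b| = -b := abs_of_neg hb_neg
  have ha : 0 < |b| := by rw [habs]; linarith
  have hmean : ∫ ω, Y 0 ω ∂μ = -|b| := by rw [habs, ← hb]; ring
  -- Taking positive parts leaves the tail on `[0, ∞)` unchanged, and only that tail enters the walk
  -- estimates.
  have hBν : ∀ v, 0 ≤ v → (μ.map (Y 0)).real (Ioi v) = tail B v := fun v hv => by
    rw [tail, hB, map_measureReal_apply (hY_meas 0) measurableSet_Ioi,
      map_measureReal_apply ((hY_meas 0).max measurable_const) measurableSet_Ioi]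
    congr 1
    ext ω
    simp [hv.not_gt]
  have hR0 : ∀ x z : ℝ, 0 ≤ z → 0 ≤ 1 / |b| * ∫ v in x..(x + z), tail B v := fun x z hz =>
    mul_nonneg (by positivity)
      (integral_nonneg_of_nonneg (fun v => tail_nonneg v) (by linarith))
  have hm0 : 0 < ∫ ω, τ 0 ω ∂μ := integral_pos_of_ae_pos (hτ_pos 0) hτ_int
  have hlam0 : 0 < lam := by rw [hlam]; positivity
  have hunif : (fun p : ℝ × ℝ => μ.real {ω | p.1 < runningMax τ Y p.2 ω})
      ~[atTop ×ˢ 𝓟 (Ioi (0 : ℝ))]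
      (fun p : ℝ × ℝ => 1 / |b| * ∫ v in p.1..(p.1 + |b| * meanCount μ τ p.2), tail B v) := by
    refine Asymptotics.isLittleO_iff.2 fun ε hε => ?_
    rw [eventually_prod_principal_iff]
    filter_upwards [eventually_abs_sub_le hτ_meas hY_meas hτ_indep hτ_ident hY_indep hY_ident
      hτY_indep hτ_pos hτ_int hY_int hB_strong hBν ha hmean hε] with x hx t ht
    rw [Pi.sub_apply, Real.norm_eq_abs, Real.norm_of_nonneg
      (hR0 _ _ (mul_nonneg ha.le (meanCount_nonneg t)))]
    exact hx t ht
  refine ⟨fun t ht => (integrable_count_and_meanCount_eq hτ_meas hτ_indep hτ_ident hτ_pos hτ_int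
    ht.le).1, hunif, ?_⟩
  have hle : (atTop ×ˢ atTop : Filter (ℝ × ℝ)) ≤ atTop ×ˢ 𝓟 (Ioi (0 : ℝ)) :=
    prod_mono le_rfl (le_principal_iff.2 (Ioi_mem_atTop 0))
  refine Asymptotics.IsEquivalent.trans (hunif.mono hle) (Asymptotics.isLittleO_iff.2 fun ε hε => ?_)
  set e := min ε 1
  have he0 : 0 < e := by positivity
  have hlim := tendsto_meanCount_div hτ_meas hτ_indep hτ_ident hτ_pos hτ_int
  rw [← hlam] at hlim
  have hev : ∀ᶠ t in atTop, 0 < t ∧ (1 - e) * (lam * t) ≤ meanCount μ τ t ∧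
      meanCount μ τ t ≤ (1 + e) * (lam * t) := by
    filter_upwards [hlim.eventually (lt_mem_nhds (show (1 - e) * lam < lam by nlinarith)),
      hlim.eventually (gt_mem_nhds (show lam < (1 + e) * lam by nlinarith)),
      eventually_gt_atTop 0] with t h1 h2 h3
    rw [lt_div_iff₀ h3] at h1
    rw [div_lt_iff₀ h3] at h2
    exact ⟨h3, by linarith, by linarith⟩
  filter_upwards [hev.prod_inr atTop] with p hp
  obtain ⟨ht, h1, h2⟩ := hp
  have hw : 0 ≤ |b| * lam * p.2 := by positivity
  rw [Pi.sub_apply, Real.norm_eq_abs, Real.norm_of_nonneg (hR0 _ _ hw), ← mul_sub, abs_mul,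
    abs_of_nonneg (show 0 ≤ 1 / |b| by positivity), mul_left_comm]
  refine mul_le_mul_of_nonneg_left ?_ (by positivity)
  have h3 := mul_le_mul_of_nonneg_left h1 ha.le
  have h4 := mul_le_mul_of_nonneg_left h2 ha.le
  refine (abs_integral_window_sub_le tail_antitone (fun v => tail_nonneg v) p.1 hw he0.le
    (min_le_right _ _) (by linarith) (by linarith)).trans ?_
  exact mul_le_mul_of_nonneg_right (min_le_left _ _)
    (integral_nonneg_of_nonneg (fun v => tail_nonneg v) (by linarith))
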